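/- \textbf{Theorem (Roth's theorem over number fields).} Let $K$ be a number field with set of places $M_K$. For $x\in K$ put $|x|_v=|\sigma(x)|^{d_v/[K:\mathbb{Q}]}$ if $v$ is the archimedean place of an embedding $\sigma:K\hookrightarrow\mathbb{C}$, where $d_v=1$ if $v$ is real and $d_v=2$ if $v$ is complex, and $|x|_v=\bigl(N(\mathfrak p)^{-\mathrm{ord}_{\mathfrak p}(x)}\bigr)^{1/[K:\mathbb{Q}]}$ (with $|0|_v=0$) if $v$ is the place of a non-zero prime $\mathfrak p$ of $\mathcal{O}_K$, $N(\mathfrak p)$ being the absolute norm of $\mathfrak p$. Let $H(x)=\prod_{v\in M_K}\max\{1,|x|_v\}$ be the Weil height of $x\in K$. Let $S\subset M_K$ be a finite set of places and, for each $v\in S$, fix any extension of $|\cdot|_v$ to an absolute value on the algebraic closure $\bar K$, again denoted by $|\cdot|_v$. Let $\alpha\in\bar K$ and $\varepsilon>0$. Then there are only finitely many $\beta\in K$ such that $$\prod_{v\in S}\min(1,|\beta-\alpha|_v)<\frac{1}{H(\beta)^{2+\varepsilon}}.$$ -/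

import Mathlib

namespace Roth

open NumberField

/-- The set `M_K` of places of a number field: the archimedean places (complex embeddings up to
conjugation) together with the non-archimedean places (non-zero primes of the ring of integers). -/
abbrev Place (K : Type*) [Field K] [NumberField K] : Type _ :=
  InfinitePlace K ⊕ FinitePlace K

variable {K : Type*} [Field K] [NumberField K]

/-- The normalized absolute value `|x|_v`. It is `|σ x| ^ (d_v / [K : ℚ])` at an archimedean place,
with `σ` a corresponding embedding and `d_v = 1` or `2` as the place is real or complex, and
`(N 𝔭 ^ (-ord_𝔭 x)) ^ (1 / [K : ℚ])` at the place of a prime `𝔭`. -/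
noncomputable def normAbs : Place K → K → ℝ
  | .inl v, x => v x ^ ((v.mult : ℝ) / (Module.finrank ℚ K : ℝ))
  | .inr v, x => v x ^ (1 / (Module.finrank ℚ K : ℝ))

/-- The Weil height `H(x) = ∏_{v ∈ M_K} max (1, |x|_v)`. -/
noncomputable def height (x : K) : ℝ :=
  ∏ᶠ v : Place K, max 1 (normAbs v x)

/-- All but finitely many factors of the product defining the height are `1`. -/
theorem height_finite_mulSupport (x : K) :
    (Function.mulSupport fun v : Place K => max 1 (normAbs v x)).Finite := by
  rcases eq_or_ne x 0 with rfl | hx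
  · have hd : (Module.finrank ℚ K : ℝ) ≠ 0 := by
      exact_mod_cast (Module.finrank_pos (R := ℚ) (M := K)).ne'
    convert Set.finite_empty
    ext v
    rcases v with v | v
    · have : ((v.mult : ℝ) / (Module.finrank ℚ K : ℝ)) ≠ 0 :=
        div_ne_zero (by exact_mod_cast v.mult_ne_zero) hd
      simp [normAbs, Real.zero_rpow this]
    · have : (Module.finrank ℚ K : ℝ)⁻¹ ≠ 0 := inv_ne_zero hd
      simp [normAbs, Real.zero_rpow this]
  · have h := FinitePlace.hasFiniteMulSupport (K := K) hx
    refine ((Set.finite_range (Sum.inl : InfinitePlace K → Place K)).union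
      (Set.Finite.image Sum.inr h)).subset ?_
    rintro (v | v) hv
    · exact Or.inl ⟨v, rfl⟩
    · refine Or.inr ⟨v, ?_, rfl⟩
      intro h1
      apply hv
      have h2 : v x = 1 := h1
      simp [normAbs, h2]

/-- `w` is an extension to `L` of the normalized absolute value `|·|_v` of `K`. -/
def Extends {L : Type*} [Field L] [Algebra K L] (w : AbsoluteValue L ℝ) (v : Place K) : Prop :=
  ∀ x : K, w (algebraMap K L x) = normAbs v x

end Roth

/-! Roth's method, carried out at several places at once. Suppose infinitely many β satisfy the
inequality. Their local exponents `-log min(1,|β-α|_v) / log H(β)` sum to more than `2+ε` over `S`,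
and a pigeonhole argument (`exists_exponents`) gives infinitely many β dominating one fixed vector κ
of sum at least `2+ε/2`. `finite_of_two_lt_sum` refutes this; there ε denotes the excess of `∑ κ v`
over 2. Three ingredients enter.

Auxiliary polynomial (`exists_auxiliary_polynomial`): Siegel's lemma gives a non-zero integer
polynomial P in m variables, with partial degrees at most `d j` and coefficients exponential in `∑ d
j`, whose Taylor expansion at (α,…,α) has only exponents J with `∑ J j / d j ≥ m(1/2-δ)`. For large
m few exponents of the box lie below that bound, so few linear conditions are imposed.

Roth's lemma (`indexBound`): if the `d j` increase rapidly and every `d j * log H(β j)` is large,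
then P has index at most δ at (β 0,…). Hence a divided derivative Q of weight at most δ is non-zero
there, while its index at (α,…,α) is still at least `m(1/2-2δ)`. The proof is by induction on the
number of variables. Writing P as a shortest sum of `f_j(x₁,…,xₙ) g_j(x₀)`, a generalized Wronskian
factors as a function of `x₁,…,xₙ` times one of `x₀`. Its index is small by the induction hypothesis
and a one-variable multiplicity bound, but large if P has large index.

Product formula (`log_inequality`): choose degrees with `d j * log H(β j)` close to a common D.
Vanishing at α gains a factor `exp(-(∑ κ v) D m(1/2-2δ))` over `S`, while all places together cost
about `exp(mD)`. Since the product of all `|Q(β)|_v` is 1, `(2+ε)(1/2-2δ)` is at most 1 plus a small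
error, which is false for small δ. -/

namespace Roth

open MvPolynomial

/-! ### Taylor expansion and divided derivatives. -/

section Translate

variable {σ R A B : Type*} [CommRing R] [CommRing A] [CommRing B] [Algebra R A] [Algebra R B]

/-- The translated polynomial `P(X + a)`. -/
noncomputable def translate (a : σ → A) : MvPolynomial σ R →ₐ[R] MvPolynomial σ A :=
  aeval fun j => X j + C (a j)

@[simp]
theorem translate_X (a : σ → A) (j : σ) :
    translate (R := R) a (X j) = X j + C (a j) := by
  simp [translate]

@[simp]
theorem translate_C (a : σ → A) (r : R) :
    translate (R := R) a (C r) = C (algebraMap R A r) := by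
  rw [translate, aeval_C]; rfl

theorem map_translate (a : σ → A) (φ : A →ₐ[R] B) (P : MvPolynomial σ R) :
    map (φ : A →+* B) (translate a P) = translate (fun j => φ (a j)) P := by
  have h : (mapAlgHom φ).comp (translate (R := R) a) = translate (R := R) fun j => φ (a j) := by
    apply MvPolynomial.algHom_ext
    intro j
    simp [mapAlgHom_apply, translate]
  exact DFunLike.congr_fun h P

/-- The divided derivative of multi-order `I`. -/
noncomputable def hasse (I : σ →₀ ℕ) (P : MvPolynomial σ R) : MvPolynomial σ R :=
  coeff I (translate (A := MvPolynomial σ R) X P)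

theorem hasse_sum {ι : Type*} (I : σ →₀ ℕ) (s : Finset ι) (P : ι → MvPolynomial σ R) :
    hasse I (∑ i ∈ s, P i) = ∑ i ∈ s, hasse I (P i) := by simp [hasse, coeff_sum]

theorem hasse_translate (I : σ →₀ ℕ) (a : σ → A) (P : MvPolynomial σ R) :
    hasse I (translate a P) = translate a (hasse I P) := by
  have h1 : translate (A := MvPolynomial σ A) X (translate a P) =
      map (translate (R := R) a : MvPolynomial σ R →+* MvPolynomial σ A)
        (translate (A := MvPolynomial σ R) X P) := by
    rw [map_translate]
    have h : ((translate (R := A) (A := MvPolynomial σ A) X).restrictScalars R).comp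
        (translate (R := R) a) = translate (R := R) fun j => translate a (X j : MvPolynomial σ R) := by
      apply MvPolynomial.algHom_ext
      intro j
      simp [add_assoc, algebraMap_eq]
    exact DFunLike.congr_fun h P
  rw [hasse, h1, coeff_map]
  rfl

theorem coeff_zero_translate (a : σ → A) (P : MvPolynomial σ R) :
    coeff 0 (translate a P) = aeval a P := by
  have h : ((constantCoeff : MvPolynomial σ A →+* A)).comp
      (translate a : MvPolynomial σ R →ₐ[R] MvPolynomial σ A).toRingHom =
      (aeval a : MvPolynomial σ R →ₐ[R] A).toRingHom := by
    apply MvPolynomial.ringHom_ext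
    · intro r; simp
    · intro j; simp
  exact DFunLike.congr_fun h P

/-- Translating back by `-a` recovers `P` with coefficients mapped to `A`. -/
theorem translate_injective_zero {a : σ → A} {P : MvPolynomial σ R}
    (hinj : Function.Injective (algebraMap R A)) (h : translate a P = 0) : P = 0 := by
  have h1 : ∀ Q : MvPolynomial σ R, translate (R := A) (fun j => - a j) (translate a Q)
      = map (algebraMap R A) Q := by
    intro Q
    induction Q using MvPolynomial.induction_on with
    | C r => simp
    | add p q hp hq => simp [hp, hq]
    | mul_X p j hp => simp [hp]
  have h2 := h1 P
  rw [h, map_zero] at h2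
  exact (map_injective _ hinj) (by rw [← h2, map_zero])

variable [Fintype σ]

/-- The product of binomial coefficients `∏ j, (e j).choose (I j)`. -/
def multiChoose (e I : σ →₀ ℕ) : ℕ := ∏ j, (e j).choose (I j)

theorem multiChoose_eq_zero {e I : σ →₀ ℕ} (h : ¬ I ≤ e) : multiChoose e I = 0 := by
  rw [Finsupp.le_def] at h
  push Not at h
  obtain ⟨j, hj⟩ := h
  exact Finset.prod_eq_zero (Finset.mem_univ j) (Nat.choose_eq_zero_of_lt hj)

theorem multiChoose_ne_zero {e I : σ →₀ ℕ} (h : I ≤ e) : multiChoose e I ≠ 0 :=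
  Finset.prod_ne_zero_iff.2 fun j _ => (Nat.choose_pos (h j)).ne'

theorem multiChoose_le (e I : σ →₀ ℕ) : multiChoose e I ≤ 2 ^ ∑ j, e j := by
  rw [← Finset.prod_pow_eq_pow_sum]
  exact Finset.prod_le_prod' fun j _ => Nat.choose_le_two_pow _ _

theorem multiChoose_self (e : σ →₀ ℕ) : multiChoose e e = 1 := by
  simp [multiChoose]

theorem translate_monomial_one (a : σ → A) (e : σ →₀ ℕ) :
    translate (R := R) a (monomial e 1) = ∏ j, (X j + C (a j)) ^ e j := by
  rw [translate, aeval_monomial, map_one, one_mul, Finsupp.prod_fintype]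
  simp

theorem coeff_prod_X_add_C_pow (a : σ → A) (e J : σ →₀ ℕ) :
    coeff J (∏ j, (X j + C (a j)) ^ e j) =
      (multiChoose e J : A) * ∏ j, a j ^ (e j - J j) := by
  classical
  have h1 : (∏ j, (X j + C (a j)) ^ e j : MvPolynomial σ A) =
      ∑ p ∈ Fintype.piFinset fun j => Finset.range (e j + 1),
        monomial (Finsupp.equivFunOnFinite.symm p)
          (∏ j, (a j ^ (e j - p j) * ((e j).choose (p j) : A))) := by
    simp_rw [add_pow]
    rw [Finset.prod_univ_sum]
    refine Finset.sum_congr rfl fun p _ => ?_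
    rw [monomial_eq, Finsupp.prod_fintype _ _ (by simp), map_prod, ← Finset.prod_mul_distrib]
    refine Finset.prod_congr rfl fun j _ => ?_
    simp
    ring
  rw [h1, coeff_sum]
  by_cases hJ : J ≤ e
  · rw [Finset.sum_eq_single (J : σ → ℕ)]
    · rw [Finsupp.equivFunOnFinite_symm_coe, coeff_monomial, if_pos rfl, Finset.prod_mul_distrib,
        multiChoose, Nat.cast_prod, mul_comm]
    · intro p _ hp
      rw [coeff_monomial, if_neg]
      rintro rfl
      exact hp (by simp)
    · intro h
      exact absurd (Fintype.mem_piFinset.2 fun j =>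
        Finset.mem_range.2 (Nat.lt_succ_of_le (hJ j))) h
  · rw [multiChoose_eq_zero hJ, Nat.cast_zero, zero_mul]
    refine Finset.sum_eq_zero fun p hp => ?_
    rw [coeff_monomial, if_neg]
    rintro rfl
    exact hJ fun j => Nat.lt_succ_iff.1 (Finset.mem_range.1 (Fintype.mem_piFinset.1 hp j))

theorem coeff_translate_monomial (a : σ → A) (e J : σ →₀ ℕ) (r : R) :
    coeff J (translate a (monomial e r)) =
      algebraMap R A r * ((multiChoose e J : A) * ∏ j, a j ^ (e j - J j)) := by
  have : (monomial e r : MvPolynomial σ R) = C r * monomial e 1 := by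
    rw [C_mul_monomial, mul_one]
  rw [this, map_mul, translate_C, translate_monomial_one, coeff_C_mul, coeff_prod_X_add_C_pow]

/-- Taylor coefficients in terms of the coefficients of the polynomial. -/
theorem coeff_translate (a : σ → A) (P : MvPolynomial σ R) (J : σ →₀ ℕ) :
    coeff J (translate a P) = ∑ e ∈ P.support,
      algebraMap R A (coeff e P) * ((multiChoose e J : A) * ∏ j, a j ^ (e j - J j)) := by
  conv_lhs => rw [P.as_sum]
  rw [map_sum, coeff_sum]
  exact Finset.sum_congr rfl fun e _ => coeff_translate_monomial a e J _

theorem hasse_eq_sum (I : σ →₀ ℕ) (P : MvPolynomial σ R) :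
    hasse I P = ∑ e ∈ P.support, monomial (e - I) (coeff e P * multiChoose e I) := by
  rw [hasse, coeff_translate]
  refine Finset.sum_congr rfl fun e _ => ?_
  rw [monomial_eq, Finsupp.prod_fintype _ _ (by simp), C_mul, ← mul_assoc]
  simp [algebraMap_eq]

theorem coeff_hasse (I e : σ →₀ ℕ) (P : MvPolynomial σ R) :
    coeff e (hasse I P) = multiChoose (e + I) I * coeff (e + I) P := by
  classical
  rw [hasse_eq_sum, coeff_sum]
  simp_rw [coeff_monomial]
  rw [Finset.sum_eq_single (e + I)]
  · simp [mul_comm]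
  · intro b _ hb
    split_ifs with h
    -- Truncated subtraction can send an exponent not above `I` to `e`; its binomial coefficient is
    -- then zero.
    · rw [multiChoose_eq_zero, Nat.cast_zero, mul_zero]
      intro hI
      exact hb (by rw [← h, tsub_add_cancel_of_le hI])
    · rfl
  · intro h
    simp [notMem_support_iff.1 h]

theorem hasse_C_mul (I : σ →₀ ℕ) (r : R) (P : MvPolynomial σ R) :
    hasse I (C r * P) = C r * hasse I P := by
  ext e
  simp only [coeff_hasse, coeff_C_mul]
  ring

theorem hasse_map {S : Type*} [CommRing S] (I : σ →₀ ℕ) (f : R →+* S) (P : MvPolynomial σ R) :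
    hasse I (map f P) = map f (hasse I P) := by
  ext e
  simp [coeff_hasse, coeff_map]

/-- The bridge between index and derivatives: a non-zero Taylor coefficient at `a` is a divided
derivative not vanishing at `a`. -/
theorem aeval_hasse (I : σ →₀ ℕ) (a : σ → A) (P : MvPolynomial σ R) :
    aeval a (hasse I P) = coeff I (translate a P) := by
  rw [← coeff_zero_translate, ← hasse_translate, coeff_hasse]
  simp [multiChoose_self]

/-- Taylor expansion at `a`. -/
theorem aeval_eq_sum_translate (a b : σ → A) (P : MvPolynomial σ R) :
    aeval b P = ∑ e ∈ (translate a P).support,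
      coeff e (translate a P) * ∏ j, (b j - a j) ^ e j := by
  have h : ((aeval (R := A) fun j => b j - a j).restrictScalars R).comp (translate (R := R) a) =
      aeval (R := R) b := by
    apply MvPolynomial.algHom_ext
    intro j
    simp
  have h2 := DFunLike.congr_fun h P
  rw [← h2]
  simp only [AlgHom.coe_comp, Function.comp_apply, AlgHom.coe_restrictScalars']
  rw [aeval_def, eval₂_eq']
  rfl

end Translate

/-! ### Lower bounds for the index. -/

section Order

variable {σ R : Type*} [CommRing R]

/-- All monomials of `P` have `ω`-weight at least `t`. -/
def SuppGE (ω : (σ →₀ ℕ) →+ ℝ) (t : ℝ) (P : MvPolynomial σ R) : Prop :=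
  ∀ e, coeff e P ≠ 0 → t ≤ ω e

variable {ω : (σ →₀ ℕ) →+ ℝ}

theorem SuppGE.mono {s t : ℝ} {P : MvPolynomial σ R} (h : SuppGE ω t P) (hst : s ≤ t) :
    SuppGE ω s P := fun e he => hst.trans (h e he)

theorem SuppGE.sum {ι : Type*} {s : Finset ι} {t : ℝ} {P : ι → MvPolynomial σ R}
    (h : ∀ i ∈ s, SuppGE ω t (P i)) : SuppGE ω t (∑ i ∈ s, P i) := by
  intro e he
  rw [coeff_sum] at he
  obtain ⟨i, hi, hne⟩ := Finset.exists_ne_zero_of_sum_ne_zero he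
  exact h i hi e hne

theorem SuppGE.mul {s t : ℝ} {P Q : MvPolynomial σ R} (hP : SuppGE ω s P) (hQ : SuppGE ω t Q) :
    SuppGE ω (s + t) (P * Q) := by
  classical
  intro e he
  rw [coeff_mul] at he
  obtain ⟨x, hx, hne⟩ := Finset.exists_ne_zero_of_sum_ne_zero he
  rw [← Finset.HasAntidiagonal.mem_antidiagonal.1 hx, map_add]
  exact add_le_add (hP _ (left_ne_zero_of_mul hne)) (hQ _ (right_ne_zero_of_mul hne))

theorem SuppGE.one : SuppGE ω 0 (1 : MvPolynomial σ R) := by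
  classical
  intro e he
  rw [coeff_one] at he
  have : 0 = e := by by_contra h; simp [h] at he
  simp [← this]

theorem SuppGE.prod {ι : Type*} {s : Finset ι} {t : ι → ℝ} {P : ι → MvPolynomial σ R}
    (h : ∀ i ∈ s, SuppGE ω (t i) (P i)) : SuppGE ω (∑ i ∈ s, t i) (∏ i ∈ s, P i) := by
  classical
  induction s using Finset.induction_on with
  | empty => simpa using SuppGE.one
  | insert i s hi ih =>
    rw [Finset.sum_insert hi, Finset.prod_insert hi]
    exact (h i (Finset.mem_insert_self i s)).mul
      (ih fun j hj => h j (Finset.mem_insert_of_mem hj))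

/-- Every term of the determinant takes one entry from each column, so column bounds add. The bound
depends on the column because, in the Wronskian, the order in the split-off variable does. -/
theorem SuppGE.det {k : ℕ} {t : Fin k → ℝ} {M : Matrix (Fin k) (Fin k) (MvPolynomial σ R)}
    (h : ∀ i j, SuppGE ω (t j) (M i j)) : SuppGE ω (∑ j, t j) M.det := by
  rw [Matrix.det_apply]
  refine SuppGE.sum fun π _ => ?_
  have h1 : SuppGE ω (∑ j, t j) (∏ i, M (π i) i) := SuppGE.prod fun i _ => h _ _
  intro e he
  refine h1 e fun h0 => he ?_
  rw [Units.smul_def, coeff_smul, h0, smul_zero]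

theorem SuppGE.hasse [Fintype σ] {t : ℝ} {P : MvPolynomial σ R} (h : SuppGE ω t P)
    (I : σ →₀ ℕ) : SuppGE ω (t - ω I) (hasse I P) := by
  intro e he
  rw [coeff_hasse] at he
  have := h _ (right_ne_zero_of_mul he)
  rw [map_add] at this
  linarith

/-- The weight `∑ j, e j / d j`. -/
noncomputable def wt [Fintype σ] (d : σ → ℕ) : (σ →₀ ℕ) →+ ℝ where
  toFun e := ∑ j, (e j : ℝ) / d j
  map_zero' := by simp
  map_add' e f := by simp [add_div, Finset.sum_add_distrib]

theorem wt_apply [Fintype σ] (d : σ → ℕ) (e : σ →₀ ℕ) : wt d e = ∑ j, (e j : ℝ) / d j := rfl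

theorem wt_nonneg [Fintype σ] (d : σ → ℕ) (e : σ →₀ ℕ) : 0 ≤ wt d e :=
  Finset.sum_nonneg fun _ _ => by positivity

end Order

/-! ### The sum of absolute values of the coefficients. -/

section Norm

variable {σ R : Type*} [CommRing R]

/-- The sum of the absolute values of the coefficients. -/
noncomputable def l1 (v : AbsoluteValue R ℝ) (P : MvPolynomial σ R) : ℝ :=
  ∑ e ∈ P.support, v (coeff e P)

variable (v : AbsoluteValue R ℝ)

theorem l1_eq_sum {P : MvPolynomial σ R} {s : Finset (σ →₀ ℕ)} (h : P.support ⊆ s) :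
    l1 v P = ∑ e ∈ s, v (coeff e P) :=
  Finset.sum_subset h fun e _ he => by rw [notMem_support_iff.1 he, map_zero]

theorem l1_nonneg (P : MvPolynomial σ R) : 0 ≤ l1 v P :=
  Finset.sum_nonneg fun _ _ => v.nonneg _

theorem l1_zero : l1 v (0 : MvPolynomial σ R) = 0 := by simp [l1]

theorem l1_monomial (e : σ →₀ ℕ) (r : R) : l1 v (monomial e r) = v r := by
  classical
  rw [l1_eq_sum v support_monomial_subset]
  simp

theorem l1_add_le (P Q : MvPolynomial σ R) : l1 v (P + Q) ≤ l1 v P + l1 v Q := by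
  classical
  rw [l1_eq_sum v (support_add (p := P) (q := Q)),
    l1_eq_sum v (Finset.subset_union_left (s₁ := P.support) (s₂ := Q.support)),
    l1_eq_sum v (Finset.subset_union_right (s₁ := P.support) (s₂ := Q.support)),
    ← Finset.sum_add_distrib]
  exact Finset.sum_le_sum fun e _ => by rw [coeff_add]; exact v.add_le _ _

theorem l1_sum_le {ι : Type*} (s : Finset ι) (P : ι → MvPolynomial σ R) :
    l1 v (∑ i ∈ s, P i) ≤ ∑ i ∈ s, l1 v (P i) := by
  classical
  induction s using Finset.induction_on with
  | empty => simp [l1_zero]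
  | insert i s hi ih =>
    rw [Finset.sum_insert hi, Finset.sum_insert hi]
    exact (l1_add_le v _ _).trans (by gcongr)

theorem l1_mul_le (P Q : MvPolynomial σ R) : l1 v (P * Q) ≤ l1 v P * l1 v Q := by
  classical
  have h : P * Q = ∑ e ∈ P.support, ∑ f ∈ Q.support,
      monomial (e + f) (coeff e P * coeff f Q) := by
    conv_lhs => rw [P.as_sum, Q.as_sum]
    simp_rw [Finset.sum_mul_sum, monomial_mul]
  rw [h, l1.eq_1 v P, l1.eq_1 v Q, Finset.sum_mul_sum]
  refine (l1_sum_le v _ _).trans (Finset.sum_le_sum fun e _ => ?_)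
  refine (l1_sum_le v _ _).trans (Finset.sum_le_sum fun f _ => ?_)
  rw [l1_monomial, map_mul]

theorem l1_prod_le [Nontrivial R] {ι : Type*} (s : Finset ι) (P : ι → MvPolynomial σ R)
    (hv : v 1 = 1) :
    l1 v (∏ i ∈ s, P i) ≤ ∏ i ∈ s, l1 v (P i) := by
  classical
  induction s using Finset.induction_on with
  | empty =>
    have := l1_monomial (σ := σ) v 0 1
    simpa [hv] using this.le
  | insert i s hi ih =>
    rw [Finset.prod_insert hi, Finset.prod_insert hi]
    exact (l1_mul_le v _ _).trans (mul_le_mul_of_nonneg_left ih (l1_nonneg v _))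

theorem coeff_le_l1 (P : MvPolynomial σ R) (e : σ →₀ ℕ) : v (coeff e P) ≤ l1 v P := by
  by_cases h : e ∈ P.support
  · exact Finset.single_le_sum (f := fun e => v (coeff e P)) (fun _ _ => v.nonneg _) h
  · rw [notMem_support_iff.1 h, map_zero]
    exact l1_nonneg v P

/-- The usual absolute value on `ℤ`, with real values. -/
noncomputable def intAbv : AbsoluteValue ℤ ℝ :=
  (AbsoluteValue.abs : AbsoluteValue ℝ ℝ).comp (f := Int.castRingHom ℝ) Int.cast_injective

@[simp]
theorem intAbv_apply (n : ℤ) : intAbv n = |(n : ℝ)| := rfl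

theorem one_le_intAbv {n : ℤ} (h : n ≠ 0) : 1 ≤ intAbv n := by
  rw [intAbv_apply]
  exact_mod_cast Int.one_le_abs h

theorem one_le_l1 {P : MvPolynomial σ ℤ} (h : P ≠ 0) : 1 ≤ l1 intAbv P := by
  obtain ⟨e, he⟩ := ne_zero_iff.1 h
  exact (one_le_intAbv he).trans (coeff_le_l1 _ _ _)

/-- Only the triangle inequality is used, so archimedean and non-archimedean `w` are covered alike;
the places of `S` later need no case distinction. -/
theorem abv_intCast_le {A : Type*} [CommRing A] [IsDomain A]
    (w : AbsoluteValue A ℝ) (n : ℤ) : w (n : A) ≤ |(n : ℝ)| := by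
  have h : ∀ k : ℕ, w (k : A) ≤ k := by
    intro k
    induction k with
    | zero => simp
    | succ k ih =>
      push_cast
      exact (w.add_le _ _).trans (by rw [map_one]; gcongr)
  rcases Int.natAbs_eq n with hn | hn
  · rw [hn]; simpa using h n.natAbs
  · rw [hn]; simpa using h n.natAbs

variable [Fintype σ]

theorem sum_le_of_degreeOf_le {d : σ → ℕ} {P : MvPolynomial σ R}
    (hd : ∀ j, degreeOf j P ≤ d j) {e : σ →₀ ℕ} (he : e ∈ P.support) :
    ∑ j, e j ≤ ∑ j, d j :=
  Finset.sum_le_sum fun j _ => (degreeOf_le_iff.1 (hd j)) e he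

theorem l1_hasse_le {d : σ → ℕ} {P : MvPolynomial σ ℤ} (hd : ∀ j, degreeOf j P ≤ d j)
    (I : σ →₀ ℕ) : l1 intAbv (hasse I P) ≤ 2 ^ (∑ j, d j) * l1 intAbv P := by
  rw [hasse_eq_sum, l1.eq_1 intAbv P, Finset.mul_sum]
  refine (l1_sum_le _ _ _).trans (Finset.sum_le_sum fun e he => ?_)
  rw [l1_monomial, map_mul, mul_comm]
  refine mul_le_mul_of_nonneg_right ?_ (AbsoluteValue.nonneg _ _)
  have h1 := (multiChoose_le e I).trans (Nat.pow_le_pow_right two_pos (sum_le_of_degreeOf_le hd he))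
  simpa using (by exact_mod_cast h1 : (multiChoose e I : ℝ) ≤ 2 ^ ∑ j, d j)

theorem degreeOf_hasse_le (P : MvPolynomial σ R) (I : σ →₀ ℕ) (j : σ) :
    degreeOf j (hasse I P) ≤ degreeOf j P := by
  rw [degreeOf_le_iff]
  intro e he
  rw [mem_support_iff, coeff_hasse] at he
  have h1 := (degreeOf_le_iff (n := j)).1 le_rfl (e + I)
    (mem_support_iff.2 (right_ne_zero_of_mul he))
  exact (Nat.le_add_right _ _).trans h1

theorem degreeOf_translate_le {A : Type*} [CommRing A] [Algebra R A]
    (P : MvPolynomial σ R) (a : σ → A) (j : σ) :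
    degreeOf j (translate a P) ≤ degreeOf j P := by
  rw [degreeOf_le_iff]
  intro e he
  rw [mem_support_iff, coeff_translate] at he
  obtain ⟨f, hf, hne⟩ := Finset.exists_ne_zero_of_sum_ne_zero he
  have h1 : e ≤ f := by
    by_contra h
    simp [multiChoose_eq_zero h] at hne
  exact (h1 j).trans (degreeOf_le_iff.1 le_rfl f hf)

theorem l1_translate_le {A : Type*} [Field A] (w : AbsoluteValue A ℝ) {d : σ → ℕ}
    {P : MvPolynomial σ ℤ} (hd : ∀ j, degreeOf j P ≤ d j) (a : σ → A) {B : ℝ} (hB1 : 1 ≤ B)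
    (hB : ∀ j, 1 + w (a j) ≤ B) :
    l1 w (translate a P) ≤ l1 intAbv P * B ^ ∑ j, d j := by
  have h : translate a P = ∑ e ∈ P.support,
      C ((coeff e P : ℤ) : A) * ∏ j, (X j + C (a j)) ^ e j := by
    conv_lhs => rw [P.as_sum]
    rw [map_sum]
    refine Finset.sum_congr rfl fun e _ => ?_
    have : (monomial e (coeff e P) : MvPolynomial σ ℤ) = C (coeff e P) * monomial e 1 := by
      rw [C_mul_monomial, mul_one]
    rw [this, map_mul, translate_C, translate_monomial_one]
    simp
  rw [h, l1.eq_1 intAbv P, Finset.sum_mul]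
  refine (l1_sum_le _ _ _).trans (Finset.sum_le_sum fun e he => ?_)
  refine (l1_mul_le _ _ _).trans ?_
  have h1 : l1 w (C ((coeff e P : ℤ) : A) : MvPolynomial σ A) ≤ intAbv (coeff e P) := by
    rw [← monomial_zero', l1_monomial]
    exact abv_intCast_le w _
  have h2 : l1 w (∏ j, (X j + C (a j)) ^ e j : MvPolynomial σ A) ≤ B ^ ∑ j, d j := by
    refine (l1_prod_le _ _ _ (map_one w)).trans ?_
    have h3 : ∀ j, l1 w ((X j + C (a j)) ^ e j : MvPolynomial σ A) ≤ B ^ e j := by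
      intro j
      have h4 := l1_prod_le w (Finset.range (e j))
        (fun _ => (X j + C (a j) : MvPolynomial σ A)) (map_one w)
      rw [Finset.prod_const, Finset.prod_const, Finset.card_range] at h4
      refine h4.trans (pow_le_pow_left₀ (l1_nonneg _ _) ?_ _)
      refine (l1_add_le _ _ _).trans (le_trans ?_ (hB j))
      rw [X, ← monomial_zero', l1_monomial, l1_monomial, map_one]
    refine (Finset.prod_le_prod (fun j _ => l1_nonneg _ _) fun j _ => h3 j).trans ?_
    rw [Finset.prod_pow_eq_pow_sum]
    exact pow_le_pow_right₀ hB1 (sum_le_of_degreeOf_le hd he)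
  exact mul_le_mul h1 h2 (l1_nonneg _ _) (AbsoluteValue.nonneg _ _)

end Norm

end Roth

namespace Roth

open MvPolynomial

/-! ### Non-vanishing of generalized Wronskians. -/

section Wronskian

variable {σ F : Type*} [Field F]

/-- A finite dimensional space of polynomials has a basis with distinct leading exponents. -/
theorem exists_distinct_leading_exponents (m : MonomialOrder σ) (T : Finset (σ →₀ ℕ)) :
    ∀ (k : ℕ) (V : Submodule F (MvPolynomial σ F)), FiniteDimensional F V →
      (∀ g ∈ V, g.support ⊆ T) → Module.finrank F V = k →
      ∃ (g : Fin k → MvPolynomial σ F) (e : Fin k → σ →₀ ℕ), Function.Injective e ∧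
        (∀ j, g j ∈ V) ∧ (∀ j, e j ∈ T) ∧ (∀ j, coeff (e j) (g j) ≠ 0) ∧
        ∀ j b, coeff b (g j) ≠ 0 → m.toSyn b ≤ m.toSyn (e j) := by
  classical
  induction T using Finset.induction_on_max_value m.toSyn with
  | empty =>
    intro k V hfd hV hk
    have : V = ⊥ := by
      rw [Submodule.eq_bot_iff]
      intro g hg
      have := hV g hg
      rwa [Finset.subset_empty, MvPolynomial.support_eq_empty] at this
    subst this
    rw [finrank_bot] at hk
    subst hk
    exact ⟨fun i => i.elim0, fun i => i.elim0, fun i => i.elim0, fun i => i.elim0,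
      fun i => i.elim0, fun i => i.elim0, fun i => i.elim0⟩
  | insert a T haT hmax ih =>
    intro k V hfd hV hk
    -- If some element of `V` has a non-zero coefficient at the largest exponent `a`, it supplies
    -- one member of the family; the kernel of that coefficient functional has dimension one less
    -- and support in `T`.
    by_cases hφ : ∀ g ∈ V, coeff a g = 0
    · obtain ⟨g, e, h1, h2, h3, h4, h5⟩ := ih k V hfd (fun g hg b hb => by
        rcases Finset.mem_insert.1 (hV g hg hb) with rfl | h
        · exact absurd (hφ g hg) (mem_support_iff.1 hb)
        · exact h) hk
      exact ⟨g, e, h1, h2, fun j => Finset.mem_insert_of_mem (h3 j), h4, h5⟩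
    · push Not at hφ
      obtain ⟨g₀, hg₀, hne⟩ := hφ
      let φ : V →ₗ[F] F := (lcoeff F a).domRestrict V
      have hφ0 : φ ≠ 0 := fun h => hne (by simpa [φ] using DFunLike.congr_fun h ⟨g₀, hg₀⟩)
      have hr : LinearMap.range φ = ⊤ := LinearMap.range_eq_top.2 (LinearMap.surjective hφ0)
      have hdim := LinearMap.finrank_range_add_finrank_ker φ
      rw [hr, finrank_top, Module.finrank_self, hk] at hdim
      obtain ⟨k, rfl⟩ : ∃ l, k = l + 1 := ⟨Module.finrank F (LinearMap.ker φ), by omega⟩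
      let V' : Submodule F (MvPolynomial σ F) := (LinearMap.ker φ).map V.subtype
      have hV' : ∀ g ∈ V', g ∈ V ∧ coeff a g = 0 := by
        rintro g ⟨x, hx, rfl⟩
        exact ⟨x.2, by simpa [φ] using hx⟩
      have hfd' : FiniteDimensional F V' := inferInstance
      obtain ⟨g, e, h1, h2, h3, h4, h5⟩ := ih k V' hfd' (fun g hg b hb => by
        rcases Finset.mem_insert.1 (hV g (hV' g hg).1 hb) with rfl | h
        · exact absurd (hV' g hg).2 (mem_support_iff.1 hb)
        · exact h) (by rw [Submodule.finrank_map_subtype_eq]; omega)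
      refine ⟨Fin.cons g₀ g, Fin.cons a e, ?_, ?_, ?_, ?_, ?_⟩
      · rw [Fin.cons_injective_iff]
        exact ⟨by rintro ⟨j, rfl⟩; exact haT (h3 j), h1⟩
      · exact Fin.cases hg₀ fun j => (hV' _ (h2 j)).1
      · exact Fin.cases (Finset.mem_insert_self _ _) fun j => Finset.mem_insert_of_mem (h3 j)
      · exact Fin.cases hne h4
      · refine Fin.cases ?_ h5
        intro b hb
        rcases Finset.mem_insert.1 (hV g₀ hg₀ (mem_support_iff.2 hb)) with rfl | h
        · exact le_rfl
        · exact hmax b h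

/-- The coefficient of a product at the sum of the leading exponents. -/
theorem coeff_prod_of_le (m : MonomialOrder σ) {ι : Type*} (s : Finset ι)
    (h : ι → MvPolynomial σ F) (e : ι → σ →₀ ℕ)
    (hh : ∀ i ∈ s, ∀ b, coeff b (h i) ≠ 0 → m.toSyn b ≤ m.toSyn (e i)) :
    coeff (∑ i ∈ s, e i) (∏ i ∈ s, h i) = ∏ i ∈ s, coeff (e i) (h i) ∧
      ∀ b, coeff b (∏ i ∈ s, h i) ≠ 0 → m.toSyn b ≤ m.toSyn (∑ i ∈ s, e i) := by
  classical
  induction s using Finset.induction_on with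
  | empty =>
    refine ⟨by simp, fun b hb => ?_⟩
    rw [Finset.prod_empty, coeff_one] at hb
    have : 0 = b := by by_contra h; simp [h] at hb
    simp [← this]
  | insert i s hi ih =>
    obtain ⟨ih1, ih2⟩ := ih fun j hj => hh j (Finset.mem_insert_of_mem hj)
    have hi' := hh i (Finset.mem_insert_self i s)
    simp only [Finset.prod_insert hi, Finset.sum_insert hi]
    constructor
    · rw [coeff_mul, Finset.sum_eq_single (e i, ∑ i ∈ s, e i), ih1]
      · rintro ⟨x, y⟩ hxy hne
        by_contra hc
        have hx := hi' x (left_ne_zero_of_mul hc)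
        have hy := ih2 y (right_ne_zero_of_mul hc)
        have hsum : m.toSyn x + m.toSyn y = m.toSyn (e i) + m.toSyn (∑ i ∈ s, e i) := by
          rw [← map_add, ← map_add, Finset.HasAntidiagonal.mem_antidiagonal.1 hxy]
        obtain ⟨h1, h2⟩ := (add_eq_add_iff_eq_and_eq hx hy).1 hsum
        exact hne (Prod.ext (m.toSyn.injective h1) (m.toSyn.injective h2))
      · intro hn
        exact absurd (by rw [Finset.HasAntidiagonal.mem_antidiagonal]) hn
    · intro b hb
      rw [coeff_mul] at hb
      obtain ⟨⟨x, y⟩, hxy, hne⟩ := Finset.exists_ne_zero_of_sum_ne_zero hb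
      rw [← Finset.HasAntidiagonal.mem_antidiagonal.1 hxy, map_add, map_add]
      exact add_le_add (hi' _ (left_ne_zero_of_mul hne)) (ih2 _ (right_ne_zero_of_mul hne))

/-- The operator `X^I ∂_I` is diagonal on monomials, so it does not raise leading exponents. -/
theorem coeff_monomial_mul_hasse [Fintype σ] (I b : σ →₀ ℕ) (P : MvPolynomial σ F) :
    coeff b (monomial I 1 * hasse I P) = multiChoose b I * coeff b P := by
  rw [coeff_monomial_mul']
  split_ifs with h
  · rw [one_mul, coeff_hasse, tsub_add_cancel_of_le h]
  · rw [multiChoose_eq_zero h]; simp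

/-- In the coordinate `x` this is `n·C(n,i) = (i+1)·C(n,i+1) + i·C(n,i)`: multiplication by a
coordinate, written in the binomial basis. -/
theorem multiChoose_mul_apply [Fintype σ] [DecidableEq σ] (e I : σ →₀ ℕ) (x : σ) :
    e x * multiChoose e I =
      (I x + 1) * multiChoose e (I + Finsupp.single x 1) + I x * multiChoose e I := by
  have h : ∀ J : σ →₀ ℕ, multiChoose e J =
      (e x).choose (J x) * ∏ j ∈ Finset.univ.erase x, (e j).choose (J j) := fun J =>
    (Finset.mul_prod_erase _ _ (Finset.mem_univ x)).symm
  have h2 : ∏ j ∈ Finset.univ.erase x, (e j).choose ((I + Finsupp.single x 1 : σ →₀ ℕ) j) =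
      ∏ j ∈ Finset.univ.erase x, (e j).choose (I j) :=
    Finset.prod_congr rfl fun j hj => by
      rw [Finsupp.add_apply, Finsupp.single_eq_of_ne (Finset.ne_of_mem_erase hj), add_zero]
  rw [h I, h (I + Finsupp.single x 1), h2, Finsupp.add_apply, Finsupp.single_eq_same]
  set p := ∏ j ∈ Finset.univ.erase x, (e j).choose (I j)
  rcases le_or_gt (I x) (e x) with hle | hlt
  · have h3 := Nat.choose_succ_right_eq (e x) (I x)
    obtain ⟨q, hq⟩ : ∃ q, e x = I x + q := ⟨e x - I x, by omega⟩
    have h4 : e x - I x = q := by omega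
    rw [h4] at h3
    calc e x * ((e x).choose (I x) * p)
        = ((e x).choose (I x) * q) * p + I x * ((e x).choose (I x) * p) := by
          generalize (e x).choose (I x) = c
          rw [hq]; ring
      _ = _ := by rw [← h3]; ring
  · rw [Nat.choose_eq_zero_of_lt hlt, Nat.choose_eq_zero_of_lt (by omega : e x < I x + 1)]
    simp

/-- Vectors of values of `multiChoose · I` with `|I| ≤ n`, at given exponents. -/
def chooseVectors (F : Type*) [Field F] [Fintype σ] {k : ℕ} (e : Fin k → σ →₀ ℕ) (n : ℕ) :
    Set (Fin k → F) :=
  {φ | ∃ I : σ →₀ ℕ, ∑ j, I j ≤ n ∧ φ = fun i => (multiChoose (e i) I : F)}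

theorem linear_mul_mem_span_chooseVectors [Fintype σ] {k : ℕ}
    (e : Fin k → σ →₀ ℕ) (n : ℕ) (x : σ) (c : F) {φ : Fin k → F}
    (hφ : φ ∈ Submodule.span F (chooseVectors F e n)) :
    (fun i => ((e i x : F) - c) * φ i) ∈ Submodule.span F (chooseVectors F e (n + 1)) := by
  classical
  induction hφ using Submodule.span_induction with
  | mem φ h =>
    obtain ⟨I, hI, rfl⟩ := h
    have h1 : (fun i => (multiChoose (e i) (I + Finsupp.single x 1) : F)) ∈
        Submodule.span F (chooseVectors F e (n + 1)) := by
      refine Submodule.subset_span ⟨_, ?_, rfl⟩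
      simp only [Finsupp.add_apply, Finset.sum_add_distrib]
      have : ∑ j, (Finsupp.single x 1 : σ →₀ ℕ) j = 1 := by
        simp [Finsupp.single_apply]
      omega
    have h2 : (fun i => (multiChoose (e i) I : F)) ∈
        Submodule.span F (chooseVectors F e (n + 1)) :=
      Submodule.subset_span ⟨I, by omega, rfl⟩
    convert Submodule.add_mem _ (Submodule.smul_mem _ (I x + 1 : F) h1)
      (Submodule.smul_mem _ (I x - c : F) h2) using 1
    ext i
    have h3 := congrArg (Nat.cast (R := F)) (multiChoose_mul_apply (e i) I x)
    push_cast at h3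
    simp only [Pi.add_apply, Pi.smul_apply, smul_eq_mul]
    rw [sub_mul, h3]
    ring
  | zero =>
    simp only [Pi.zero_apply, mul_zero]
    exact Submodule.zero_mem _
  | add φ ψ _ _ h1 h2 =>
    convert Submodule.add_mem _ h1 h2 using 1
    ext i
    simp [mul_add]
  | smul a φ _ h1 =>
    convert Submodule.smul_mem _ a h1 using 1
    ext i
    simp only [Pi.smul_apply, smul_eq_mul]
    ring

/-- Lagrange interpolation: two distinct exponents differ in some coordinate, and a product of `k -
1` linear factors `e j x - e i x` vanishes at all the exponents but a chosen one. Each linear factor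
raises the binomial order by at most one. Characteristic zero keeps distinct exponents distinct in
`F`. -/
theorem span_chooseVectors_eq_top [CharZero F] [Fintype σ] {k : ℕ} (e : Fin k → σ →₀ ℕ)
    (he : Function.Injective e) : Submodule.span F (chooseVectors F e (k - 1)) = ⊤ := by
  classical
  have key : ∀ (i₀ : Fin k) (T : Finset (Fin k)), i₀ ∉ T →
      ∃ φ ∈ Submodule.span F (chooseVectors F e T.card), φ i₀ ≠ 0 ∧ ∀ i ∈ T, φ i = 0 := by
    intro i₀ T
    induction T using Finset.induction_on with
    | empty =>
      intro _
      refine ⟨fun i => (multiChoose (e i) 0 : F), Submodule.subset_span ⟨0, by simp, rfl⟩, ?_, ?_⟩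
      · exact Nat.cast_ne_zero.2 (multiChoose_ne_zero (fun _ => Nat.zero_le _))
      · simp
    | insert i T hi ih =>
      intro hi₀
      obtain ⟨φ, hφ, hne, h0⟩ := ih fun h => hi₀ (Finset.mem_insert_of_mem h)
      have hii : e i₀ ≠ e i := fun h => hi₀ (by rw [he h]; exact Finset.mem_insert_self _ _)
      obtain ⟨x, hx⟩ := DFunLike.ne_iff.1 hii
      refine ⟨fun j => ((e j x : F) - e i x) * φ j, ?_, ?_, ?_⟩
      · rw [Finset.card_insert_of_notMem hi]
        exact linear_mul_mem_span_chooseVectors e _ x _ hφ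
      · exact mul_ne_zero (sub_ne_zero.2 (Nat.cast_injective.ne hx)) hne
      · intro j hj
        rcases Finset.mem_insert.1 hj with rfl | hj
        · simp
        · simp [h0 j hj]
  rw [eq_top_iff]
  have hsingle : ∀ i₀ : Fin k, Pi.single i₀ (1 : F) ∈
      Submodule.span F (chooseVectors F e (k - 1)) := by
    intro i₀
    obtain ⟨φ, hφ, hne, h0⟩ := key i₀ (Finset.univ.erase i₀) (Finset.notMem_erase _ _)
    rw [Finset.card_erase_of_mem (Finset.mem_univ _), Finset.card_univ, Fintype.card_fin] at hφ
    convert Submodule.smul_mem _ (φ i₀)⁻¹ hφ using 1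
    ext i
    rcases eq_or_ne i i₀ with rfl | hi
    · simp [hne]
    · simp [hi, h0 i (Finset.mem_erase.2 ⟨hi, Finset.mem_univ _⟩)]
  intro ψ _
  rw [pi_eq_sum_univ ψ]
  refine Submodule.sum_mem _ fun i _ => Submodule.smul_mem _ _ ?_
  convert hsingle i using 1
  ext j
  simp [Pi.single_apply, eq_comm]

theorem exists_det_multiChoose_ne_zero [CharZero F] [Fintype σ] {k : ℕ} (e : Fin k → σ →₀ ℕ)
    (he : Function.Injective e) :
    ∃ I : Fin k → σ →₀ ℕ, (∀ i, ∑ x, I i x ≤ k - 1) ∧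
      (Matrix.of fun i j => (multiChoose (e j) (I i) : F)).det ≠ 0 := by
  have htop := span_chooseVectors_eq_top (F := F) e he
  obtain ⟨f, hf, -, hli⟩ :=
    Submodule.exists_fun_fin_finrank_span_eq F (chooseVectors F e (k - 1))
  have hk : Module.finrank F (Submodule.span F (chooseVectors F e (k - 1))) = k := by
    rw [htop, finrank_top, Module.finrank_fin_fun]
  choose I hI hfI using hf
  refine ⟨fun i => I (Fin.cast hk.symm i), fun i => hI _, ?_⟩
  have h2 : LinearIndependent F
      (Matrix.of fun i j => (multiChoose (e j) (I (Fin.cast hk.symm i)) : F)).row := by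
    have h3 : (Matrix.of fun i j => (multiChoose (e j) (I (Fin.cast hk.symm i)) : F)).row =
        f ∘ Fin.cast hk.symm := by
      ext i j
      simp [hfI, Matrix.row]
    rw [h3]
    exact hli.comp (Fin.cast hk.symm) (Fin.cast_injective _)
  rw [Matrix.linearIndependent_rows_iff_isUnit, Matrix.isUnit_iff_isUnit_det] at h2
  exact h2.ne_zero

/-- Linearly independent polynomials have a non-vanishing generalized Wronskian. -/
theorem exists_det_hasse_ne_zero [CharZero F] [Fintype σ] [LinearOrder σ] {k : ℕ}
    (f : Fin k → MvPolynomial σ F) (hf : LinearIndependent F f) :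
    ∃ I : Fin k → σ →₀ ℕ, (∀ i, ∑ x, I i x ≤ k - 1) ∧
      (Matrix.of fun i j => hasse (I i) (f j)).det ≠ 0 := by
  classical
  let m : MonomialOrder σ := MonomialOrder.lex
  let V := Submodule.span F (Set.range f)
  obtain ⟨g, e, he, hgV, -, hne, hle⟩ := exists_distinct_leading_exponents m
    (Finset.univ.biUnion fun j => (f j).support) k V
    (FiniteDimensional.span_of_finite F (Set.finite_range f)) (by
      intro g hg
      induction hg using Submodule.span_induction with
      | mem x h =>
        obtain ⟨j, rfl⟩ := h
        exact Finset.subset_biUnion_of_mem (fun j => (f j).support) (Finset.mem_univ j)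
      | zero => simp
      | add x y _ _ hx hy => exact support_add.trans (Finset.union_subset hx hy)
      | smul a x _ hx => exact support_smul.trans hx)
    (by simpa using finrank_span_eq_card hf)
  obtain ⟨I, hI, hdet⟩ := exists_det_multiChoose_ne_zero (F := F) e he
  refine ⟨I, hI, fun h0 => ?_⟩
  have hA : ∀ j, ∃ a : Fin k → F, ∑ i, a i • f i = g j := fun j =>
    (Submodule.mem_span_range_iff_exists_fun F).1 (hgV j)
  choose a ha using hA
  have hdetg : (Matrix.of fun i j => hasse (I i) (g j)).det = 0 := by
    have : (Matrix.of fun i j => hasse (I i) (g j)) =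
        (Matrix.of fun i j => hasse (I i) (f j)) * Matrix.of fun i j => C (a j i) := by
      ext1 i j
      rw [Matrix.mul_apply, Matrix.of_apply, ← ha j, hasse_sum]
      refine Finset.sum_congr rfl fun l _ => ?_
      rw [smul_eq_C_mul, hasse_C_mul, Matrix.of_apply, Matrix.of_apply, mul_comm]
    rw [this, Matrix.det_mul, h0, zero_mul]
  -- Multiplying row `i` by `X^(I i)` makes the leading exponent of column `j` at most `e j`. The
  -- coefficient of the determinant at `∑ e j` is then a scalar determinant of binomials times the
  -- leading coefficients.
  have hM : (Matrix.of fun i j => monomial (I i) (1 : F) * hasse (I i) (g j)).det = 0 := by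
    have := Matrix.det_mul_column (fun i => monomial (I i) (1 : F))
      (Matrix.of fun i j => hasse (I i) (g j))
    simp only [Matrix.of_apply] at this
    rw [this, hdetg, mul_zero]
  apply hdet
  have hc : coeff (∑ j, e j)
      (Matrix.of fun i j => monomial (I i) (1 : F) * hasse (I i) (g j)).det =
      (Matrix.of fun i j => coeff (e j) (g j) * (multiChoose (e j) (I i) : F)).det := by
    rw [Matrix.det_apply, Matrix.det_apply, coeff_sum]
    refine Finset.sum_congr rfl fun π _ => ?_
    rw [Units.smul_def, Units.smul_def, coeff_smul]
    congr 1
    rw [(coeff_prod_of_le m Finset.univ _ e ?_).1]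
    · refine Finset.prod_congr rfl fun j _ => ?_
      rw [Matrix.of_apply, Matrix.of_apply, coeff_monomial_mul_hasse, mul_comm]
    · intro j _ b hb
      rw [Matrix.of_apply, coeff_monomial_mul_hasse] at hb
      exact hle j b (right_ne_zero_of_mul hb)
  have hd := Matrix.det_mul_row (fun j => coeff (e j) (g j))
    (Matrix.of fun i j => (multiChoose (e j) (I i) : F))
  simp only [Matrix.of_apply] at hd
  rw [hM, coeff_zero, hd] at hc
  exact (mul_eq_zero.1 hc.symm).resolve_left (Finset.prod_ne_zero_iff.2 fun j _ => hne j)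

end Wronskian

end Roth

namespace Roth

open NumberField

/-! ### Multiplicity of a root against its height. -/

section OneVariable

open Polynomial Height

variable {K : Type*} [Field K] [NumberField K]

theorem finitePlace_intCast_le_one (v : FinitePlace K) (n : ℤ) : v (n : K) ≤ 1 := by
  have h := FinitePlace.norm_le_one K v.maximalIdeal (n : 𝓞 K)
  rw [← FinitePlace.norm_embedding_eq v (n : K)]
  simpa using h

theorem finitePlace_isNonarchimedean (v : FinitePlace K) : IsNonarchimedean v.val :=
  fun x y => FinitePlace.add_le v x y

/-- Gauss's lemma: the Gauss norm is multiplicative, is at most 1 on integer polynomials, and bounds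
each coefficient of `X - β` and of `Q`. -/
theorem finitePlace_leadingCoeff_mul_le {V : ℤ[X]} {β : K} {s : ℕ} {Q : K[X]}
    (hQ : V.map (Int.castRingHom K) = (X - C β) ^ s * Q) (v : FinitePlace K) :
    v (Q.leadingCoeff) * max (v β) 1 ^ s ≤ 1 := by
  have hna := finitePlace_isNonarchimedean v
  have h1 : gaussNorm v.val 1 (V.map (Int.castRingHom K)) ≤ 1 := by
    obtain ⟨i, hi⟩ := exists_eq_gaussNorm v.val 1 (V.map (Int.castRingHom K))
    rw [hi, one_pow, mul_one, coeff_map]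
    exact finitePlace_intCast_le_one v _
  have hpow : ∀ n, gaussNorm v.val 1 ((X - C β) ^ n) = gaussNorm v.val 1 (X - C β) ^ n := by
    intro n
    induction n with
    | zero =>
      rw [pow_zero, pow_zero, ← C_1, gaussNorm_C, map_one]
    | succ n ih => rw [pow_succ, gaussNorm_mul hna one_pos, ih, pow_succ]
  rw [hQ, gaussNorm_mul hna one_pos, hpow] at h1
  refine le_trans ?_ h1
  rw [mul_comm]
  have h2 := le_gaussNorm v.val Q zero_le_one Q.natDegree
  have h3 : max (v β) 1 ≤ gaussNorm v.val 1 (X - C β) := by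
    refine max_le ?_ ?_
    · have := le_gaussNorm v.val (X - C β) zero_le_one 0
      simpa [FinitePlace.coe_apply] using this
    · have := le_gaussNorm v.val (X - C β) zero_le_one 1
      simpa [coeff_X, coeff_C] using this
  rw [one_pow, mul_one] at h2
  exact mul_le_mul (pow_le_pow_left₀ (by positivity) h3 _) h2 (apply_nonneg v _)
    (pow_nonneg (gaussNorm_nonneg _ _ zero_le_one) _)

/-- The Mahler measure replaces the Gauss norm: it is multiplicative, bounded above by the sum of
the coefficients' absolute values and below by the leading coefficient. -/
theorem infinitePlace_leadingCoeff_mul_le {K : Type*} [Field K] {V : ℤ[X]} {β : K} {s : ℕ} {Q : K[X]}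
    (hQ : V.map (Int.castRingHom K) = (X - C β) ^ s * Q) (v : InfinitePlace K) :
    v (Q.leadingCoeff) * max (v β) 1 ^ s ≤ ∑ i ∈ V.support, |(V.coeff i : ℝ)| := by
  have hmap : V.map (Int.castRingHom ℂ) =
      (X - C (v.embedding β)) ^ s * Q.map v.embedding := by
    have := congrArg (Polynomial.map v.embedding) hQ
    rw [Polynomial.map_map] at this
    rw [show Int.castRingHom ℂ = v.embedding.comp (Int.castRingHom K) from RingHom.ext_int _ _,
      this]
    simp
  have h1 := mahlerMeasure_le_sum_norm_coeff (V.map (Int.castRingHom ℂ))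
  have hsum : ((V.map (Int.castRingHom ℂ)).sum fun _ a => ‖a‖) =
      ∑ i ∈ V.support, |(V.coeff i : ℝ)| := by
    rw [Polynomial.sum_def, support_map_of_injective _ (RingHom.injective_int _)]
    refine Finset.sum_congr rfl fun i _ => ?_
    simp
  have hpow : ∀ n, ((X - C (v.embedding β)) ^ n).mahlerMeasure =
      (X - C (v.embedding β)).mahlerMeasure ^ n := by
    intro n
    induction n with
    | zero => simp
    | succ n ih => rw [pow_succ, mahlerMeasure_mul, ih, pow_succ]
  rw [hsum, hmap, mahlerMeasure_mul, hpow, mahlerMeasure_X_sub_C,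
    InfinitePlace.norm_embedding_eq] at h1
  refine le_trans ?_ h1
  rw [mul_comm, max_comm]
  gcongr
  have h2 := leadingCoeff_le_mahlerMeasure (Q.map v.embedding)
  rwa [leadingCoeff_map, InfinitePlace.norm_embedding_eq] at h2

/-- The multiplicity of a root of an integer polynomial is bounded in terms of the heights. -/
theorem exists_coeff_taylor_ne_zero (V : ℤ[X]) (hV : V ≠ 0) (β : K) :
    ∃ s : ℕ, (taylor β (V.map (Int.castRingHom K))).coeff s ≠ 0 ∧
      s * logHeight₁ β ≤
        Module.finrank ℚ K * Real.log (∑ i ∈ V.support, |(V.coeff i : ℝ)|) := by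
  have hinj : Function.Injective (Int.castRingHom K) := RingHom.injective_int _
  have hV' : V.map (Int.castRingHom K) ≠ 0 := (Polynomial.map_ne_zero_iff hinj).2 hV
  obtain ⟨Q, hQ, hdvd⟩ := exists_eq_pow_rootMultiplicity_mul_and_not_dvd _ hV' β
  set s := rootMultiplicity β (V.map (Int.castRingHom K)) with hs
  refine ⟨s, ?_, ?_⟩
  -- As `s` is the exact multiplicity, the Taylor coefficient of order `s` is `Q(β)`, which is
  -- non-zero.
  · rw [hQ, taylor_mul, taylor_pow]
    have : taylor β (X - C β) = (X : K[X]) := by simp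
    rw [this, mul_comm, coeff_mul_X_pow', if_pos le_rfl, Nat.sub_self, taylor_coeff_zero]
    exact fun h => hdvd (dvd_iff_isRoot.2 h)
  · have hQ0 : Q ≠ 0 := fun h => hdvd (by rw [h]; exact dvd_zero _)
    have ha : Q.leadingCoeff ≠ 0 := leadingCoeff_ne_zero.2 hQ0
    set L := ∑ i ∈ V.support, |(V.coeff i : ℝ)| with hL
    have hfa := FinitePlace.hasFiniteMulSupport (K := K) ha
    have hfβ : (fun v : FinitePlace K => max (v β) 1).HasFiniteMulSupport := by
      rcases eq_or_ne β 0 with rfl | hβ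
      · simpa using! (Function.hasFiniteMulSupport_fun_one : Function.HasFiniteMulSupport (1 : FinitePlace K → ℝ))
      · exact (FinitePlace.hasFiniteMulSupport hβ).max Function.hasFiniteMulSupport_fun_one
    have hfs : (fun v : FinitePlace K => max (v β) 1 ^ s).HasFiniteMulSupport := hfβ.pow s
    -- The product formula for the leading coefficient of `Q` inserts a factor 1, after which the
    -- local bounds apply place by place.
    have key : mulHeight₁ β ^ s ≤ L ^ Module.finrank ℚ K := by
      calc mulHeight₁ β ^ s
          = ((∏ v : InfinitePlace K, v Q.leadingCoeff ^ v.mult) *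
              ∏ᶠ v : FinitePlace K, v Q.leadingCoeff) *
            ((∏ v : InfinitePlace K, max (v β) 1 ^ v.mult) *
              ∏ᶠ v : FinitePlace K, max (v β) 1) ^ s := by
            rw [prod_abs_eq_one ha, one_mul, NumberField.mulHeight₁_eq]
        _ = (∏ v : InfinitePlace K, (v Q.leadingCoeff * max (v β) 1 ^ s) ^ v.mult) *
              ∏ᶠ v : FinitePlace K, (v Q.leadingCoeff * max (v β) 1 ^ s) := by
            rw [finprod_mul_distrib hfa hfs, mul_pow, finprod_pow hfβ,
              ← Finset.prod_pow, mul_mul_mul_comm, ← Finset.prod_mul_distrib]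
            congr 1
            refine Finset.prod_congr rfl fun v _ => ?_
            rw [mul_pow, ← pow_mul, ← pow_mul, mul_comm s]
        _ ≤ (∏ v : InfinitePlace K, L ^ v.mult) * 1 := by
            refine mul_le_mul ?_ ?_ (finprod_nonneg fun v => by positivity)
              (Finset.prod_nonneg fun v _ => by positivity)
            · refine Finset.prod_le_prod (fun v _ => by positivity) fun v _ => ?_
              gcongr
              exact infinitePlace_leadingCoeff_mul_le hQ v
            · refine (finprod_le_finprod (hfa.mul hfs) (fun v => ?_)
                Function.hasFiniteMulSupport_fun_one fun v => ?_).trans_eq finprod_one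
              · exact mul_nonneg (apply_nonneg v _) (by positivity)
              · exact finitePlace_leadingCoeff_mul_le hQ v
        _ = L ^ Module.finrank ℚ K := by
            rw [mul_one, Finset.prod_pow_eq_pow_sum, InfinitePlace.sum_mult_eq]
    have h2 := Real.log_le_log (pow_pos (mulHeight₁_pos β) s) key
    rwa [Real.log_pow, Real.log_pow] at h2

end OneVariable

end Roth

namespace Roth

open MvPolynomial

/-! ### Separating the variable `x₀` from the others. -/

section SplitVariable

variable {n : ℕ} {R A : Type*} [CommRing R] [CommRing A] [Algebra R A]

/-- The product `f(x₁, …, xₙ) g(x₀)`. -/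
noncomputable def splitMul (f : MvPolynomial (Fin n) R) (g : MvPolynomial (Fin 1) R) :
    MvPolynomial (Fin (n + 1)) R :=
  rename Fin.succ f * rename (fun _ => 0) g

theorem coeff_splitMul (f : MvPolynomial (Fin n) R) (g : MvPolynomial (Fin 1) R)
    (e : Fin (n + 1) →₀ ℕ) :
    coeff e (splitMul f g) = coeff e.tail f * coeff (Finsupp.single 0 (e 0)) g := by
  classical
  induction f using MvPolynomial.induction_on' with
  | add p q hp hq =>
    simp only [splitMul, map_add, add_mul, coeff_add] at hp hq ⊢
    rw [hp, hq]
  | monomial a r =>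
    induction g using MvPolynomial.induction_on' with
    | add p q hp hq =>
      simp only [splitMul, map_add, mul_add, coeff_add] at hp hq ⊢
      rw [hp, hq]
    | monomial b t =>
      rw [splitMul, rename_monomial, rename_monomial, monomial_mul, coeff_monomial,
        coeff_monomial, coeff_monomial]
      have hs : Finsupp.mapDomain Fin.succ a + Finsupp.mapDomain (fun _ : Fin 1 => 0) b =
          Finsupp.cons (b 0) a := by
        ext j
        refine Fin.cases ?_ (fun j => ?_) j
        · have h0 : Finsupp.mapDomain Fin.succ a (0 : Fin (n + 1)) = 0 :=
            Finsupp.mapDomain_of_notMem_range _ _ (by simp)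
          have h1 : b = Finsupp.single 0 (b 0) := Finsupp.unique_single b
          rw [Finsupp.add_apply, h0, h1, Finsupp.mapDomain_single]
          simp
        · have h1 : b = Finsupp.single 0 (b 0) := Finsupp.unique_single b
          rw [Finsupp.add_apply, Finsupp.mapDomain_apply (Fin.succ_injective n), h1,
            Finsupp.mapDomain_single]
          simp
      rw [hs]
      have h2 : Finsupp.cons (b 0) a = e ↔ a = e.tail ∧ b = Finsupp.single 0 (e 0) := by
        constructor
        · rintro rfl
          exact ⟨by simp, by rw [Finsupp.cons_zero]; exact Finsupp.unique_single b⟩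
        · rintro ⟨h1, h2⟩
          rw [h1, h2, Finsupp.single_eq_same, Finsupp.cons_tail]
      simp only [h2]
      by_cases h3 : a = e.tail <;> by_cases h4 : b = Finsupp.single 0 (e 0) <;>
        simp [h3, h4]

theorem hasse_splitMul (J : Fin (n + 1) →₀ ℕ) (f : MvPolynomial (Fin n) R)
    (g : MvPolynomial (Fin 1) R) :
    hasse J (splitMul f g) = splitMul (hasse J.tail f) (hasse (Finsupp.single 0 (J 0)) g) := by
  ext e
  have h1 : multiChoose (e + J) J = multiChoose (e.tail + J.tail) J.tail *
      multiChoose (Finsupp.single (0 : Fin 1) (e 0) + Finsupp.single 0 (J 0))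
        (Finsupp.single 0 (J 0)) := by
    simp only [multiChoose, Fin.prod_univ_succ, Fin.prod_univ_zero, Finsupp.add_apply,
      Finsupp.single_eq_same, Finsupp.tail_apply]
    ring
  have h2 : (e + J).tail = e.tail + J.tail := by
    ext j; simp [Finsupp.tail_apply]
  rw [coeff_hasse, coeff_splitMul, coeff_splitMul, coeff_hasse, coeff_hasse, h1, h2,
    Finsupp.add_apply, Finsupp.single_add]
  push_cast
  ring

theorem translate_splitMul (a : Fin (n + 1) → A) (f : MvPolynomial (Fin n) R)
    (g : MvPolynomial (Fin 1) R) :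
    translate a (splitMul f g) =
      splitMul (translate (fun j => a j.succ) f) (translate (fun _ => a 0) g) := by
  have h : ∀ {σ τ : Type} (u : σ → τ) (b : τ → A) (p : MvPolynomial σ R),
      translate b (rename u p) = rename u (translate (fun j => b (u j)) p) := by
    intro σ τ u b p
    induction p using MvPolynomial.induction_on with
    | C r => simp
    | add p q hp hq => simp [hp, hq]
    | mul_X p j hp => simp [hp]
  rw [splitMul, map_mul, h, h, splitMul]

/-- The coefficients of a slice are coefficients of `W`, so integrality and size are inherited;
injectivity keeps the support finite. -/
theorem exists_slice {σ τ : Type*} (φ : (τ →₀ ℕ) → σ →₀ ℕ) (hφ : Function.Injective φ)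
    (W : MvPolynomial σ R) : ∃ U : MvPolynomial τ R, ∀ a, coeff a U = coeff (φ a) W := by
  classical
  refine ⟨∑ a ∈ W.support.preimage φ hφ.injOn, monomial a (coeff (φ a) W), fun a => ?_⟩
  rw [coeff_sum]
  simp only [coeff_monomial, Finset.sum_ite_eq', Finset.mem_preimage]
  split_ifs with h
  · rfl
  · exact (notMem_support_iff.1 h).symm

theorem l1_slice_le {σ τ : Type*} (v : AbsoluteValue R ℝ) {φ : (τ →₀ ℕ) → σ →₀ ℕ}
    (hφ : Function.Injective φ) {W : MvPolynomial σ R} {U : MvPolynomial τ R}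
    (h : ∀ a, coeff a U = coeff (φ a) W) : l1 v U ≤ l1 v W := by
  classical
  have h1 : U.support.image φ ⊆ W.support := by
    intro e he
    obtain ⟨a, ha, rfl⟩ := Finset.mem_image.1 he
    rw [mem_support_iff] at ha ⊢
    rwa [← h]
  rw [l1, l1]
  calc ∑ e ∈ U.support, v (coeff e U) = ∑ e ∈ U.support.image φ, v (coeff e W) := by
        rw [Finset.sum_image hφ.injOn]
        exact Finset.sum_congr rfl fun e _ => by rw [h]
    _ ≤ _ := Finset.sum_le_sum_of_subset_of_nonneg h1 fun _ _ _ => v.nonneg _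

/-- A polynomial is a short sum of products `f(x₁, …, xₙ) g(x₀)` with linearly independent
factors. -/
theorem exists_splitMul_decomposition {F : Type*} [Field F] {P : MvPolynomial (Fin (n + 1)) F}
    (hP : P ≠ 0) {D : ℕ} (hD : degreeOf 0 P ≤ D) :
    ∃ (k : ℕ) (f : Fin k → MvPolynomial (Fin n) F) (g : Fin k → MvPolynomial (Fin 1) F),
      0 < k ∧ k ≤ D + 1 ∧ LinearIndependent F f ∧ LinearIndependent F g ∧
      P = ∑ j, splitMul (f j) (g j) := by
  classical
  have hslice : ∀ i : Fin (D + 1), ∃ U : MvPolynomial (Fin n) F,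
      ∀ a, coeff a U = coeff (Finsupp.cons (i : ℕ) a) P :=
    fun i => exists_slice _ (Finsupp.cons_right_injective _) P
  choose p hp using hslice
  -- The coefficients `p i` of the powers of `x₀` span `M`. A basis of `M` supplies the `f j`, and
  -- the coordinates of the `p i` supply the coefficients of the `g j`.
  let M := Submodule.span F (Set.range p)
  have hfd : FiniteDimensional F M := FiniteDimensional.span_of_finite F (Set.finite_range p)
  let b := Module.finBasis F M
  let q : Fin (D + 1) → M := fun i => ⟨p i, Submodule.subset_span ⟨i, rfl⟩⟩
  let g : Fin (Module.finrank F M) → MvPolynomial (Fin 1) F := fun j =>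
    ∑ i : Fin (D + 1), monomial (Finsupp.single 0 (i : ℕ)) (b.repr (q i) j)
  have hg : ∀ j (l : ℕ), coeff (Finsupp.single 0 l) (g j) =
      if h : l < D + 1 then b.repr (q ⟨l, h⟩) j else 0 := by
    intro j l
    simp only [g, coeff_sum, coeff_monomial]
    split_ifs with h
    · rw [Finset.sum_eq_single ⟨l, h⟩]
      · simp
      · intro i _ hi
        rw [if_neg]
        intro h2
        exact hi (Fin.ext (Finsupp.single_injective _ h2))
      · simp
    · refine Finset.sum_eq_zero fun i _ => ?_
      rw [if_neg]
      intro h2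
      exact h (Finsupp.single_injective _ h2 ▸ i.2)
  have hPsum : P = ∑ j, splitMul (b j : MvPolynomial (Fin n) F) (g j) := by
    ext e
    rw [coeff_sum]
    simp only [coeff_splitMul, hg]
    by_cases h : e 0 < D + 1
    · simp only [dif_pos h]
      have h1 : coeff e P = coeff e.tail (p ⟨e 0, h⟩) := by
        rw [hp, Finsupp.cons_tail]
      have h2 : p ⟨e 0, h⟩ = ∑ j, b.repr (q ⟨e 0, h⟩) j • (b j : MvPolynomial (Fin n) F) := by
        have := congrArg Subtype.val (b.sum_repr (q ⟨e 0, h⟩))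
        rw [AddSubmonoidClass.coe_finsetSum] at this
        exact this.symm
      rw [h1, h2, coeff_sum]
      exact Finset.sum_congr rfl fun j _ => by rw [coeff_smul, smul_eq_mul, mul_comm]
    · simp only [dif_neg h, mul_zero, Finset.sum_const_zero]
      by_contra hne
      have := degreeOf_le_iff.1 hD e (mem_support_iff.2 hne)
      omega
  refine ⟨Module.finrank F M, fun j => b j, g, ?_, ?_, ?_, ?_, hPsum⟩
  · rw [Nat.pos_iff_ne_zero]
    intro h0
    apply hP
    rw [hPsum]
    have : IsEmpty (Fin (Module.finrank F M)) := by rw [h0]; infer_instance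
    simp
  · exact (finrank_range_le_card (R := F) p).trans_eq (Fintype.card_fin _)
  · exact b.linearIndependent.map' M.subtype (Submodule.ker_subtype _)
  · rw [Fintype.linearIndependent_iff]
    intro c hc
    -- A relation `c` among the `g j` is a functional on `M` with values `c j` on the basis; it
    -- kills every `p i`, and these span `M`.
    let φ : M →ₗ[F] F := b.constr F c
    have hφq : ∀ i, φ (q i) = 0 := by
      intro i
      have h1 := congrArg (coeff (Finsupp.single 0 (i : ℕ))) hc
      simp only [coeff_sum, coeff_smul, hg, dif_pos i.2, coeff_zero, smul_eq_mul] at h1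
      simp only [φ, Module.Basis.constr_apply_fintype, smul_eq_mul, Module.Basis.equivFun_apply]
      rw [← h1]
      exact Finset.sum_congr rfl fun j _ => mul_comm _ _
    have hφ : φ = 0 := by
      have hle : M ≤ (LinearMap.ker φ).map M.subtype := by
        refine Submodule.span_le.2 ?_
        rintro _ ⟨i, rfl⟩
        exact ⟨q i, hφq i, rfl⟩
      ext x
      obtain ⟨y, hy, hxy⟩ := hle x.2
      rw [show x = y from Subtype.ext hxy.symm]
      exact hy
    intro j
    have h2 := DFunLike.congr_fun hφ (b j)
    simpa [φ] using h2

end SplitVariable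

/-! ### A Wronskian that factors. -/

section Wronskian

variable {n : ℕ}

/-- A non-zero Wronskian of an integer polynomial that splits as a product
`f(x₁, …, xₙ) g(x₀)`. -/
theorem exists_split_wronskian {P : MvPolynomial (Fin (n + 1)) ℤ} (hP : P ≠ 0) {D : ℕ}
    (hD : degreeOf 0 P ≤ D) :
    ∃ (k : ℕ) (I : Fin k → Fin n →₀ ℕ) (ν : Fin k → ℕ), 0 < k ∧ k ≤ D + 1 ∧
      (∀ i, ∑ x, I i x ≤ k - 1) ∧ (∀ l, ν l < k) ∧ Function.Injective ν ∧
      (Matrix.of fun i l => hasse (Finsupp.cons (ν l) (I i)) P).det ≠ 0 ∧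
      ∃ (U : MvPolynomial (Fin n) ℚ) (V : MvPolynomial (Fin 1) ℚ),
        map (Int.castRingHom ℚ)
          (Matrix.of fun i l => hasse (Finsupp.cons (ν l) (I i)) P).det = splitMul U V := by
  classical
  have hinj : Function.Injective (Int.castRingHom ℚ) := RingHom.injective_int _
  have hP' : map (Int.castRingHom ℚ) P ≠ 0 := fun h =>
    hP (map_injective _ hinj (by rw [h, map_zero]))
  have hD' : degreeOf 0 (map (Int.castRingHom ℚ) P) ≤ D := by
    rw [degreeOf_le_iff] at hD ⊢
    exact fun e he => hD e (support_map_subset _ _ he)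
  obtain ⟨k, f, g, hk, hkD, hf, hg, hdec⟩ := exists_splitMul_decomposition hP' hD'
  obtain ⟨I, hI, hU⟩ := exists_det_hasse_ne_zero f hf
  obtain ⟨N, hN, hV⟩ := exists_det_hasse_ne_zero g hg
  have hN' : ∀ l, N l = Finsupp.single 0 (N l 0) := fun l => Finsupp.unique_single _
  set M : Matrix (Fin k) (Fin k) (MvPolynomial (Fin (n + 1)) ℤ) :=
    Matrix.of fun i l => hasse (Finsupp.cons (N l 0) (I i)) P with hM
  set U := (Matrix.of fun i j => hasse (I i) (f j)).det with hUdef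
  set V := (Matrix.of fun i j => hasse (N i) (g j)).det with hVdef
  have hmap : map (Int.castRingHom ℚ) M.det = splitMul U V := by
    -- The decomposition exhibits the matrix as the Wronskian matrix of the `f j` times the
    -- transpose of that of the `g j`.
    have h1 : (map (Int.castRingHom ℚ)).mapMatrix M =
        ((rename Fin.succ).mapMatrix (Matrix.of fun i j => hasse (I i) (f j))) *
        ((rename fun _ : Fin 1 => (0 : Fin (n + 1))).mapMatrix
          (Matrix.of fun i j => hasse (N i) (g j))).transpose := by
      ext1 i l
      rw [Matrix.mul_apply]
      simp only [RingHom.mapMatrix_apply, AlgHom.mapMatrix_apply, Matrix.map_apply,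
        Matrix.transpose_apply, Matrix.of_apply, hM]
      rw [← hasse_map, hdec, hasse_sum]
      refine Finset.sum_congr rfl fun j _ => ?_
      rw [hasse_splitMul, Finsupp.tail_cons, Finsupp.cons_zero, ← hN' l, splitMul]
    rw [RingHom.map_det, h1, Matrix.det_mul, Matrix.det_transpose, ← AlgHom.map_det,
      ← AlgHom.map_det, splitMul]
  have hne : M.det ≠ 0 := by
    obtain ⟨a, ha⟩ := ne_zero_iff.1 hU
    obtain ⟨b, hb⟩ := ne_zero_iff.1 hV
    intro h0
    rw [h0, map_zero] at hmap
    have h1 := congrArg (coeff (Finsupp.cons (b 0) a)) hmap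
    have hb' : b = Finsupp.single 0 (b 0) := Finsupp.unique_single b
    rw [coeff_splitMul, coeff_zero, Finsupp.tail_cons, Finsupp.cons_zero, ← hb'] at h1
    exact mul_ne_zero ha hb h1.symm
  refine ⟨k, I, fun l => N l 0, hk, hkD, hI, ?_, ?_, hne, U, V, hmap⟩
  · intro l
    have := hN l
    simp only [Fin.sum_univ_succ, Fin.sum_univ_zero] at this
    change N l 0 < k
    omega
  -- Equal orders would give equal rows in the Wronskian of the `g j`.
  · intro l l' hll
    by_contra hne'
    refine hV (Matrix.det_zero_of_row_eq hne' ?_)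
    ext1 j
    have : N l = N l' := by rw [hN' l, hN' l']; exact congrArg _ hll
    simp [this]

end Wronskian

end Roth

namespace Roth

open MvPolynomial NumberField Height

/-! ### The multiplicity bound in the multivariate formalism. -/

section OneVariable

variable {K : Type*} [Field K] [NumberField K]

theorem coeff_aeval_X {R : Type*} [CommRing R] (F : MvPolynomial (Fin 1) R) (i : ℕ) :
    (aeval (fun _ : Fin 1 => (Polynomial.X : Polynomial R)) F).coeff i =
      coeff (Finsupp.single 0 i) F := by
  classical
  induction F using MvPolynomial.induction_on' with
  | add p q hp hq => simp [hp, hq]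
  | monomial e r =>
    have he : e = Finsupp.single 0 (e 0) := Finsupp.unique_single e
    rw [aeval_monomial, he, Finsupp.prod_single_index (by simp), coeff_monomial, Polynomial.algebraMap_eq, Polynomial.coeff_C_mul_X_pow]
    simp only [(Finsupp.single_injective (0 : Fin 1)).eq_iff, eq_comm]

theorem exists_coeff_translate_ne_zero (V : MvPolynomial (Fin 1) ℤ) (hV : V ≠ 0) (β : K) :
    ∃ s : ℕ, coeff (Finsupp.single 0 s) (translate (fun _ => β) V) ≠ 0 ∧
      s * logHeight₁ β ≤ Module.finrank ℚ K * Real.log (l1 intAbv V) := by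
  classical
  set V₁ : Polynomial ℤ := aeval (fun _ : Fin 1 => (Polynomial.X : Polynomial ℤ)) V with hV₁
  have hc : ∀ i, V₁.coeff i = coeff (Finsupp.single 0 i) V := coeff_aeval_X V
  have hne : V₁ ≠ 0 := by
    obtain ⟨e, he⟩ := ne_zero_iff.1 hV
    intro h
    apply he
    rw [show e = Finsupp.single 0 (e 0) from Finsupp.unique_single e, ← hc, h,
      Polynomial.coeff_zero]
  obtain ⟨s, hs, hle⟩ := exists_coeff_taylor_ne_zero V₁ hne β
  refine ⟨s, ?_, hle.trans ?_⟩
  · have h1 : aeval (fun _ : Fin 1 => (Polynomial.X : Polynomial K)) (translate (fun _ => β) V) =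
        Polynomial.taylor β (V₁.map (Int.castRingHom K)) := by
      rw [hV₁]
      clear_value V₁
      clear hV₁ hc hne hs hle hV
      induction V using MvPolynomial.induction_on with
      | C r =>
        rw [translate_C, aeval_C, aeval_C, Polynomial.algebraMap_eq, Polynomial.algebraMap_eq,
          Polynomial.map_C, Polynomial.taylor_C]
        rfl
      | add p q hp hq => simp only [map_add, hp, hq, Polynomial.map_add]
      | mul_X p j hp =>
        simp only [map_mul, hp, Polynomial.map_mul, Polynomial.taylor_mul]
        simp
    rw [← coeff_aeval_X, h1]
    exact hs
  · have hsub : V₁.support.image (fun i => (Finsupp.single 0 i : Fin 1 →₀ ℕ)) ⊆ V.support := by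
      intro e he
      obtain ⟨i, hi, rfl⟩ := Finset.mem_image.1 he
      rw [mem_support_iff, ← hc]
      exact Polynomial.mem_support_iff.1 hi
    have hsum : ∑ i ∈ V₁.support, |(V₁.coeff i : ℝ)| ≤ l1 intAbv V := by
      calc ∑ i ∈ V₁.support, |(V₁.coeff i : ℝ)|
          = ∑ e ∈ V₁.support.image (fun i => (Finsupp.single 0 i : Fin 1 →₀ ℕ)),
              intAbv (coeff e V) := by
            rw [Finset.sum_image (Finsupp.single_injective _).injOn]
            exact Finset.sum_congr rfl fun i _ => by rw [hc, intAbv_apply]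
        _ ≤ _ := Finset.sum_le_sum_of_subset_of_nonneg hsub fun _ _ _ => intAbv.nonneg _
    have hpos : 0 < ∑ i ∈ V₁.support, |(V₁.coeff i : ℝ)| :=
      Finset.sum_pos (fun i hi => abs_pos.2 (Int.cast_ne_zero.2 (Polynomial.mem_support_iff.1 hi)))
        (Polynomial.support_nonempty.2 hne)
    gcongr

end OneVariable

/-! ### Roth's lemma. -/

section RothLemma

theorem l1_det_le {σ : Type*} {k : ℕ} (M : Matrix (Fin k) (Fin k) (MvPolynomial σ ℤ)) {B : ℝ}
    (hB : ∀ i j, l1 intAbv (M i j) ≤ B) : l1 intAbv M.det ≤ k.factorial * B ^ k := by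
  have h1 : ∀ π : Equiv.Perm (Fin k),
      l1 intAbv (Equiv.Perm.sign π • ∏ i, M (π i) i) ≤ B ^ k := by
    intro π
    have h2 : l1 intAbv (Equiv.Perm.sign π • ∏ i, M (π i) i) = l1 intAbv (∏ i, M (π i) i) := by
      rcases Int.units_eq_one_or (Equiv.Perm.sign π) with h | h
      · rw [h, one_smul]
      · rw [h, Units.neg_smul, one_smul, l1, l1, support_neg]
        simp
    rw [h2]
    refine (l1_prod_le _ _ _ (map_one _)).trans ?_
    refine (Finset.prod_le_prod (fun i _ => l1_nonneg _ _) fun i _ => hB _ i).trans_eq ?_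
    simp
  rw [Matrix.det_apply]
  refine (l1_sum_le _ _ _).trans ((Finset.sum_le_sum fun π _ => h1 π).trans_eq ?_)
  simp [Fintype.card_perm]

theorem degreeOf_det_le {σ R : Type*} [CommRing R] {k : ℕ}
    (M : Matrix (Fin k) (Fin k) (MvPolynomial σ R)) (x : σ) {D : ℕ}
    (hD : ∀ i j, degreeOf x (M i j) ≤ D) : degreeOf x M.det ≤ k * D := by
  -- An upper bound on a degree is a lower bound for the weight `-e x`, so `SuppGE.det` applies.
  let ω : (σ →₀ ℕ) →+ ℝ :=
    { toFun e := -(e x : ℝ)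
      map_zero' := by simp
      map_add' e f := by simp; ring }
  have h1 : SuppGE ω (∑ _j : Fin k, -(D : ℝ)) M.det := by
    refine SuppGE.det fun i j e he => neg_le_neg ?_
    exact_mod_cast degreeOf_le_iff.1 (hD i j) e (mem_support_iff.2 he)
  rw [degreeOf_le_iff]
  intro e he
  have h2 : (∑ _j : Fin k, -(D : ℝ)) ≤ -(e x : ℝ) := h1 e (mem_support_iff.1 he)
  rw [Finset.sum_const, Finset.card_univ, Fintype.card_fin, nsmul_eq_mul] at h2
  have h3 : (e x : ℝ) ≤ k * D := by linarith
  exact_mod_cast h3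

/-- The terms with `ν ≤ θD/2` are at least `θ/2`, and `k ≤ D + 1` ensures that at least `kθ/4`
indices below `k` qualify. -/
theorem le_sum_max_sub_div {k D : ℕ} (hD : 0 < D) (hk : k ≤ D + 1) {θ : ℝ} (hθ : 0 < θ)
    (hθ1 : θ ≤ 1) :
    k * (θ ^ 2 / 8) ≤ ∑ ν ∈ Finset.range k, max 0 (θ - ν / D) := by
  have hD' : (0 : ℝ) < D := by exact_mod_cast hD
  set M := ⌊θ * D / 2⌋₊ + 1 with hM
  have h1 : (min k M : ℕ) * (θ / 2) ≤ ∑ ν ∈ Finset.range k, max 0 (θ - ν / D) := by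
    calc (min k M : ℕ) * (θ / 2) = ∑ _ν ∈ Finset.range (min k M), θ / 2 := by simp
      _ ≤ ∑ ν ∈ Finset.range (min k M), max 0 (θ - ν / D) := by
          refine Finset.sum_le_sum fun ν hν => le_max_of_le_right ?_
          have h2 : ν ≤ ⌊θ * D / 2⌋₊ := by
            have := Finset.mem_range.1 hν
            omega
          have h3 : (ν : ℝ) ≤ θ * D / 2 := (Nat.le_floor_iff (by positivity)).1 h2
          have h4 : (ν : ℝ) / D ≤ θ / 2 := by
            rw [div_le_iff₀ hD']; linarith
          linarith
      _ ≤ _ := by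
          refine Finset.sum_le_sum_of_subset_of_nonneg ?_ fun _ _ _ => le_max_left _ _
          exact Finset.range_subset_range.2 (min_le_left _ _)
  refine le_trans ?_ h1
  have h5 : (k : ℝ) * (θ / 4) ≤ (min k M : ℕ) := by
    rcases min_choice k M with h | h
    · rw [h]
      have : (0 : ℝ) ≤ k := Nat.cast_nonneg k
      nlinarith
    · rw [h]
      have h6 : θ * D / 2 < M := by
        rw [hM]; push_cast; exact Nat.lt_floor_add_one _
      have h7 : (1 : ℝ) ≤ M := by exact_mod_cast Nat.succ_le_succ (Nat.zero_le _)
      have h8 : (k : ℝ) ≤ D + 1 := by exact_mod_cast hk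
      nlinarith
  nlinarith

/-- An upper bound for the index at a point whose coordinates have large and rapidly decreasing
heights, for polynomials in `n` variables. -/
def IndexBound (K : Type*) [Field K] [NumberField K] (n : ℕ) : Prop :=
  ∀ η : ℝ, 0 < η → ∃ C : ℝ, 1 ≤ C ∧ ∀ (d : Fin n → ℕ) (β : Fin n → K)
    (P : MvPolynomial (Fin n) ℤ), (∀ j, 0 < d j) → (∀ i j, i < j → C * d i ≤ d j) → P ≠ 0 →
    (∀ j, degreeOf j P ≤ d j) →
    (∀ j, C * (Real.log (l1 intAbv P) + ∑ i, (d i : ℝ)) ≤ d j * logHeight₁ (β j)) →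
    ∃ e, coeff e (translate β P) ≠ 0 ∧ wt d e ≤ η

/-- The Wronskian of `exists_split_wronskian` is, up to a constant, a product of two of its
slices; this bounds its index. -/
theorem exists_coeff_translate_det_ne_zero {K : Type*} [Field K] {n : ℕ} {W : MvPolynomial (Fin (n + 1)) ℤ}
    (hW : W ≠ 0) {U₀ : MvPolynomial (Fin n) ℚ} {V₀ : MvPolynomial (Fin 1) ℚ}
    (hWs : map (Int.castRingHom ℚ) W = splitMul U₀ V₀) :
    ∃ (U : MvPolynomial (Fin n) ℤ) (V : MvPolynomial (Fin 1) ℤ), U ≠ 0 ∧ V ≠ 0 ∧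
      l1 intAbv U ≤ l1 intAbv W ∧ l1 intAbv V ≤ l1 intAbv W ∧
      (∀ j, degreeOf j U ≤ degreeOf j.succ W) ∧
      ∀ (β : Fin (n + 1) → K) (a : Fin n →₀ ℕ) (s : ℕ),
        coeff a (translate (fun j => β j.succ) U) ≠ 0 →
        coeff (Finsupp.single 0 s) (translate (fun _ => β 0) V) ≠ 0 →
        coeff (Finsupp.cons s a) (translate β W) ≠ 0 := by
  obtain ⟨e, he⟩ := ne_zero_iff.1 hW
  have hφ : Function.Injective fun b : Fin 1 →₀ ℕ => Finsupp.cons (b 0) e.tail := by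
    intro b b' h
    ext
    exact (Finsupp.cons_injective2 h).1
  obtain ⟨U, hU⟩ := exists_slice _ (Finsupp.cons_right_injective (e 0)) W
  obtain ⟨V, hV⟩ := exists_slice _ hφ W
  -- The coefficients of `W` form a rank-one array over ℚ, so its 2×2 minors vanish. Slicing through
  -- a non-zero entry `e` gives an integral factorization, up to that entry.
  have hrank : C (coeff e W) * W = splitMul U V := by
    have hq : ∀ b, ((coeff b W : ℤ) : ℚ) = coeff b.tail U₀ * coeff (Finsupp.single 0 (b 0)) V₀ := by
      intro b
      rw [← coeff_splitMul, ← hWs, coeff_map]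
      rfl
    ext b
    rw [coeff_C_mul, coeff_splitMul, hU, hV]
    apply Int.cast_injective (α := ℚ)
    push_cast
    rw [hq, hq, hq, hq]
    simp only [Finsupp.tail_cons, Finsupp.cons_zero, Finsupp.single_eq_same]
    ring
  refine ⟨U, V, ?_, ?_, l1_slice_le _ (Finsupp.cons_right_injective _) hU,
    l1_slice_le _ hφ hV, ?_, ?_⟩
  · rw [ne_zero_iff]
    exact ⟨e.tail, by rwa [hU, Finsupp.cons_tail]⟩
  · rw [ne_zero_iff]
    exact ⟨Finsupp.single 0 (e 0), by rwa [hV, Finsupp.single_eq_same, Finsupp.cons_tail]⟩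
  · intro j
    rw [degreeOf_le_iff]
    intro a ha
    rw [mem_support_iff, hU] at ha
    have := degreeOf_le_iff.1 (le_refl (degreeOf j.succ W)) _ (mem_support_iff.2 ha)
    simpa using this
  · intro β a s ha hs h0
    have h1 := congrArg (fun F => coeff (Finsupp.cons s a) (translate β F)) hrank
    simp only [map_mul, translate_C, coeff_C_mul, h0, mul_zero, translate_splitMul,
      coeff_splitMul, Finsupp.tail_cons, Finsupp.cons_zero] at h1
    exact mul_ne_zero ha hs h1.symm

variable {K : Type*} [Field K] [NumberField K]

theorem indexBound_zero : IndexBound K 0 := by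
  intro η hη
  refine ⟨1, le_rfl, fun d β P _ _ hP _ _ => ?_⟩
  have h1 : translate β P ≠ 0 := fun h =>
    hP (translate_injective_zero (RingHom.injective_int (algebraMap ℤ K)) h)
  obtain ⟨e, he⟩ := ne_zero_iff.1 h1
  exact ⟨e, he, by simpa [wt_apply] using hη.le⟩

/-- If `P` had index at least `η`, summing over the `k` columns would give the Wronskian index at
least `kη²/32`; its two factors allow at most `kη²/128` each. -/
theorem indexBound_succ {n : ℕ} (ih : IndexBound K n) : IndexBound K (n + 1) := by
  intro η₀ hη₀
  set η := min η₀ 1 with hη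
  have hη0 : 0 < η := lt_min hη₀ one_pos
  have hη1 : η ≤ 1 := min_le_right _ _
  set N : ℝ := (Module.finrank ℚ K : ℝ) with hN
  have hN0 : 0 ≤ N := Nat.cast_nonneg _
  obtain ⟨C', hC'1, hC'⟩ := ih (η ^ 2 / 128) (by positivity)
  -- The summands serve, in order, the induction hypothesis for `U`, the cost of differentiating in
  -- `x₁,…,xₙ`, and the multiplicity of `V` at `β 0`.
  set C := 3 * C' + 2 / η + 256 * N / η ^ 2 with hC
  have hC1 : 3 * C' ≤ C := by
    have : 0 ≤ 2 / η + 256 * N / η ^ 2 := by positivity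
    linarith
  have hC2 : 2 / η ≤ C := by
    have : 0 ≤ 3 * C' + 256 * N / η ^ 2 := by positivity
    linarith
  have hC3 : 256 * N / η ^ 2 ≤ C := by
    have : 0 ≤ 3 * C' + 2 / η := by positivity
    linarith
  have hCpos : 0 < C := by linarith
  refine ⟨C, by linarith, fun d β P hd hdd hP hdeg hh => ?_⟩
  by_contra hcon
  push Not at hcon
  have hord : SuppGE (wt d) η (translate β P) := fun e he =>
    (min_le_left _ _).trans (hcon e he).le
  obtain ⟨k, I, ν, hk, hkD, hI, hν, hνinj, hW, U₀, V₀, hWs⟩ :=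
    exists_split_wronskian hP (hdeg 0)
  set M := Matrix.of fun i l => hasse (Finsupp.cons (ν l) (I i)) P with hM
  obtain ⟨U, V, hU, hV, hUW, hVW, hUdeg, hcoeff⟩ :=
    exists_coeff_translate_det_ne_zero (K := K) hW hWs
  set L := Real.log (l1 intAbv P) with hL
  set D : ℝ := ∑ i, (d i : ℝ) with hDdef
  have hL0 : 0 ≤ L := Real.log_nonneg (one_le_l1 hP)
  have hd0 : (1 : ℝ) ≤ d 0 := by exact_mod_cast hd 0
  have hD1 : (d 0 : ℝ) ≤ D := Finset.single_le_sum (f := fun i => (d i : ℝ))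
    (fun _ _ => Nat.cast_nonneg _) (Finset.mem_univ 0)
  have hk' : (0 : ℝ) < k := by exact_mod_cast hk
  -- the size of the Wronskian
  have hWlog : Real.log (l1 intAbv M.det) ≤ k * (L + 2 * D) := by
    have h1 : l1 intAbv M.det ≤ k.factorial * (2 ^ (∑ j, d j) * l1 intAbv P) ^ k :=
      l1_det_le M fun i j => l1_hasse_le hdeg _
    -- Since `k ≤ d 0 + 1 ≤ 2 ^ d 0`, the number of terms costs no more than the binomials do.
    have h2 : (k.factorial : ℝ) ≤ (2 ^ (∑ j, d j)) ^ k := by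
      have h3 : k ≤ 2 ^ d 0 := hkD.trans (Nat.lt_two_pow_self)
      have h4 : 2 ^ d 0 ≤ 2 ^ ∑ j, d j := Nat.pow_le_pow_right two_pos
        (Finset.single_le_sum (f := d) (fun _ _ => Nat.zero_le _) (Finset.mem_univ 0))
      have h5 := (Nat.factorial_le_pow k).trans (Nat.pow_le_pow_left (h3.trans h4) k)
      exact_mod_cast h5
    have hl1 : 0 < l1 intAbv P := lt_of_lt_of_le one_pos (one_le_l1 hP)
    have h6 : l1 intAbv M.det ≤ ((2 ^ (∑ j, d j)) ^ 2 * l1 intAbv P) ^ k := by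
      refine h1.trans ?_
      calc (k.factorial : ℝ) * (2 ^ (∑ j, d j) * l1 intAbv P) ^ k
          ≤ (2 ^ (∑ j, d j)) ^ k * (2 ^ (∑ j, d j) * l1 intAbv P) ^ k := by gcongr
        _ = _ := by rw [← mul_pow]; ring
    refine (Real.log_le_log (lt_of_lt_of_le one_pos (one_le_l1 hW)) h6).trans ?_
    rw [Real.log_pow, Real.log_mul (by positivity) hl1.ne', Real.log_pow, Real.log_pow]
    have h7 : Real.log 2 ≤ 1 := by linarith [Real.log_two_lt_d9]
    have h8 : ((∑ j, d j : ℕ) : ℝ) = D := by push_cast; rfl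
    rw [h8]
    have hD0 : 0 ≤ D := by linarith
    have h9 : D * Real.log 2 ≤ D := by nlinarith
    refine mul_le_mul_of_nonneg_left ?_ hk'.le
    push_cast
    linarith
  -- an exponent for the slice `U`
  have hstep : ∃ a, coeff a (translate (fun j => β j.succ) U) ≠ 0 ∧
      wt (fun j => k * d j.succ) a ≤ η ^ 2 / 128 := by
    -- Degrees and logarithmic size of the Wronskian both grow by the factor `k`, which cancels from
    -- the hypotheses.
    refine hC' (fun j => k * d j.succ) (fun j => β j.succ) U
      (fun j => Nat.mul_pos hk (hd _)) ?_ hU ?_ ?_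
    · intro i j hij
      have h1 := hdd i.succ j.succ (Fin.succ_lt_succ_iff.2 hij)
      have h2 : C' * d i.succ ≤ d j.succ := le_trans (by gcongr; linarith) h1
      push_cast
      calc C' * (k * d i.succ) = k * (C' * d i.succ) := by ring
        _ ≤ _ := by gcongr
    · intro j
      exact (hUdeg j).trans (degreeOf_det_le M _ fun i l =>
        (degreeOf_hasse_le _ _ _).trans (hdeg _))
    · intro j
      have h1 : Real.log (l1 intAbv U) ≤ k * (L + 2 * D) :=
        (Real.log_le_log (lt_of_lt_of_le one_pos (one_le_l1 hU)) hUW).trans hWlog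
      have h2 : ∑ i : Fin n, ((k * d i.succ : ℕ) : ℝ) ≤ k * D := by
        push_cast
        rw [← Finset.mul_sum, hDdef, Fin.sum_univ_succ]
        gcongr
        linarith
      calc C' * (Real.log (l1 intAbv U) + ∑ i : Fin n, ((k * d i.succ : ℕ) : ℝ))
          ≤ C' * (k * (L + 2 * D) + k * D) := by gcongr
        _ ≤ k * (3 * C' * (L + D)) := by
            nlinarith [mul_nonneg hk'.le (mul_nonneg (by linarith : 0 ≤ C') hL0)]
        _ ≤ k * (C * (L + D)) := by gcongr
        _ ≤ k * (d j.succ * logHeight₁ (β j.succ)) := mul_le_mul_of_nonneg_left (hh _) hk'.le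
        _ = _ := by push_cast; ring
  obtain ⟨a, ha, hawt⟩ := hstep
  obtain ⟨s, hs, hsle⟩ := exists_coeff_translate_ne_zero V hV (β 0)
  have hne := hcoeff β a s ha hs
  -- upper bound for the index of the Wronskian
  have hupper : wt d (Finsupp.cons s a) ≤ k * (η ^ 2 / 64) := by
    have h1 : wt d (Finsupp.cons s a) = s / d 0 + k * wt (fun j => k * d j.succ) a := by
      rw [wt_apply, wt_apply, Fin.sum_univ_succ, Finset.mul_sum]
      simp only [Finsupp.cons_zero, Finsupp.cons_succ]
      congr 1
      refine Finset.sum_congr rfl fun j _ => ?_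
      have : (d j.succ : ℝ) ≠ 0 := by exact_mod_cast (hd j.succ).ne'
      push_cast
      field_simp
    have h2 : (s : ℝ) / d 0 ≤ k * (η ^ 2 / 128) := by
      set h := logHeight₁ (β 0) with hhdef
      have hhh := hh 0
      have hpos : 0 < h := by
        have h3 : 0 < C * (L + D) := by apply mul_pos hCpos; linarith
        by_contra hneg
        have : (d 0 : ℝ) * h ≤ 0 := mul_nonpos_of_nonneg_of_nonpos (by linarith) (not_lt.1 hneg)
        linarith
      have h4 : Real.log (l1 intAbv V) ≤ k * (L + 2 * D) :=
        (Real.log_le_log (lt_of_lt_of_le one_pos (one_le_l1 hV)) hVW).trans hWlog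
      have h5 : (s : ℝ) * h * C ≤ 2 * N * k * (d 0 * h) := by
        calc (s : ℝ) * h * C ≤ (N * Real.log (l1 intAbv V)) * C := by gcongr
          _ ≤ (N * (k * (L + 2 * D))) * C := by gcongr
          _ ≤ (N * (k * (2 * (L + D)))) * C := by gcongr; linarith
          _ = 2 * N * k * (C * (L + D)) := by ring
          _ ≤ _ := by gcongr
      have h6 : (s : ℝ) * C ≤ 2 * N * k * d 0 := by
        refine le_of_mul_le_mul_right ?_ hpos
        calc (s : ℝ) * C * h = s * h * C := by ring
          _ ≤ _ := h5
          _ = _ := by ring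
      have h7 : 256 * N ≤ C * η ^ 2 := (div_le_iff₀ (by positivity)).1 hC3
      rw [div_le_iff₀ (by linarith)]
      refine le_of_mul_le_mul_right ?_ hCpos
      calc (s : ℝ) * C ≤ 2 * N * k * d 0 := h6
        _ = (256 * N) * (k * d 0 / 128) := by ring
        _ ≤ (C * η ^ 2) * (k * d 0 / 128) := by gcongr
        _ = _ := by ring
    rw [h1]
    have h3 : (k : ℝ) * wt (fun j => k * d j.succ) a ≤ k * (η ^ 2 / 128) := by gcongr
    linarith
  -- lower bound for the index of the Wronskian
  have hlower : SuppGE (wt d) (∑ l, max 0 (η / 2 - ν l / d 0)) (translate β M.det) := by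
    have hdet : translate β M.det = (Matrix.of fun i l =>
        hasse (Finsupp.cons (ν l) (I i)) (translate β P)).det := by
      rw [AlgHom.map_det]
      congr 1
      ext1 i l
      simp only [AlgHom.mapMatrix_apply, Matrix.map_apply, hM, Matrix.of_apply]
      rw [hasse_translate]
    rw [hdet]
    refine SuppGE.det fun i l => ?_
    rw [Matrix.of_apply]
    intro e he
    refine max_le (wt_nonneg d e) ?_
    refine le_trans ?_ (hord.hasse _ e he)
    -- The orders in `x₁,…,xₙ` total at most `k - 1 ≤ d 0`, while these variables have degree bounds
    -- at least `C * d 0`.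
    have h1 : wt d (Finsupp.cons (ν l) (I i)) ≤ ν l / d 0 + η / 2 := by
      rw [wt_apply, Fin.sum_univ_succ]
      simp only [Finsupp.cons_zero, Finsupp.cons_succ]
      gcongr
      calc ∑ j, (I i j : ℝ) / d j.succ ≤ ∑ j, (I i j : ℝ) * (1 / (C * d 0)) := by
            refine Finset.sum_le_sum fun j _ => ?_
            rw [div_eq_mul_one_div]
            gcongr
            exact hdd 0 j.succ (Fin.succ_pos j)
        _ = (∑ j, I i j : ℕ) * (1 / (C * d 0)) := by push_cast; rw [Finset.sum_mul]
        _ ≤ d 0 * (1 / (C * d 0)) := by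
            gcongr
            exact_mod_cast (hI i).trans (by omega)
        _ = 1 / C := by field_simp
        _ ≤ η / 2 := by
            rw [div_le_iff₀ hη0] at hC2
            rw [div_le_iff₀ hCpos]
            linarith
    linarith
  have hsum : ∑ l, max 0 (η / 2 - (ν l : ℝ) / d 0) =
      ∑ m ∈ Finset.range k, max 0 (η / 2 - (m : ℝ) / d 0) := by
    have himg : Finset.univ.image ν = Finset.range k := by
      apply Finset.eq_of_subset_of_card_le
      · intro x hx
        obtain ⟨l, -, rfl⟩ := Finset.mem_image.1 hx
        exact Finset.mem_range.2 (hν l)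
      · rw [Finset.card_image_of_injective _ hνinj]
        simp
    rw [← himg, Finset.sum_image hνinj.injOn]
  have hfin := hlower _ hne
  rw [hsum] at hfin
  have hcount := le_sum_max_sub_div (hd 0) hkD (θ := η / 2) (by positivity) (by linarith)
  have h1 : (k : ℝ) * ((η / 2) ^ 2 / 8) ≤ k * (η ^ 2 / 64) := hcount.trans (hfin.trans hupper)
  have h2 := le_of_mul_le_mul_left h1 hk'
  nlinarith [pow_pos hη0 2]

/-- Roth's lemma. -/
theorem indexBound (n : ℕ) : IndexBound K n := by
  induction n with
  | zero => exact indexBound_zero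
  | succ n ih => exact indexBound_succ ih

end RothLemma

end Roth

namespace Roth

open MvPolynomial

/-! ### The auxiliary polynomial. -/

section Auxiliary

/-- Siegel's lemma; with twice as many unknowns as equations its exponent is at most 1. -/
theorem exists_small_int_solution {ι κ : Type*} [Fintype ι] [Fintype κ] (A : Matrix ι κ ℤ)
    (h0 : 0 < Fintype.card ι) (h : 2 * Fintype.card ι ≤ Fintype.card κ) {B : ℝ} (hB1 : 1 ≤ B)
    (hB : ∀ i j, |(A i j : ℝ)| ≤ B) :
    ∃ t : κ → ℤ, t ≠ 0 ∧ A.mulVec t = 0 ∧ ∀ j, |(t j : ℝ)| ≤ Fintype.card κ * B := by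
  let _ : SeminormedAddCommGroup (Matrix ι κ ℤ) := Matrix.seminormedAddCommGroup
  obtain ⟨t, ht0, ht, hle⟩ := Int.Matrix.exists_ne_zero_int_vec_norm_le A (by omega) h0
  refine ⟨t, ht0, ht, fun j => ?_⟩
  have hA : ‖A‖ ≤ B := (Matrix.norm_le_iff (by linarith)).2 fun i j => by
    rw [Int.norm_eq_abs]; exact hB i j
  have hn : (1 : ℝ) ≤ Fintype.card κ := by exact_mod_cast (by omega : 1 ≤ Fintype.card κ)
  have h2 : 2 * (Fintype.card ι : ℝ) ≤ Fintype.card κ := by exact_mod_cast h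
  have h0' : (0 : ℝ) < Fintype.card ι := by exact_mod_cast h0
  have hbase : 1 ≤ (Fintype.card κ : ℝ) * max 1 ‖A‖ :=
    one_le_mul_of_one_le_of_one_le hn (le_max_left _ _)
  calc |(t j : ℝ)| = ‖t j‖ := (Int.norm_eq_abs _).symm
    _ ≤ ‖t‖ := norm_le_pi_norm t j
    _ ≤ _ := hle
    _ ≤ ((Fintype.card κ : ℝ) * max 1 ‖A‖) ^ (1 : ℝ) := by
        refine Real.rpow_le_rpow_of_exponent_le hbase ?_
        rw [div_le_one (by linarith)]
        linarith
    _ ≤ _ := by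
        rw [Real.rpow_one]
        gcongr
        exact max_le hB1 hA

/-- Multiplying by `a` shifts the coefficients, and a monic equation `f` reduces the top power, so
sizes grow by at most `1 + ∑ |f_l|`. Any monic equation will do: the lower powers need not be
independent. -/
theorem exists_pow_eq_sum {L : Type*} [CommRing L] [Nontrivial L] {a : L} (ha : IsIntegral ℤ a) :
    ∃ r B : ℕ, 0 < r ∧ 1 ≤ B ∧ ∀ k : ℕ, ∃ A : Fin r → ℤ, (∀ l, |A l| ≤ (B : ℤ) ^ k) ∧
      a ^ k = ∑ l, (A l : L) * a ^ (l : ℕ) := by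
  obtain ⟨f, hf, hfa⟩ := ha
  have hr : f.natDegree ≠ 0 := by
    intro h
    rw [hf.natDegree_eq_zero] at h
    rw [h] at hfa
    simp at hfa
  obtain ⟨r, hr'⟩ := Nat.exists_eq_succ_of_ne_zero hr
  have hpow : a ^ (r + 1) = -∑ l : Fin (r + 1), (f.coeff l : L) * a ^ (l : ℕ) := by
    have h1 : Polynomial.aeval a f = 0 := hfa
    rw [Polynomial.aeval_eq_sum_range, hr', Finset.sum_range_succ, ← Nat.succ_eq_add_one, ← hr',
      hf.coeff_natDegree, one_smul, hr'] at h1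
    rw [Fin.sum_univ_eq_sum_range (fun l => (f.coeff l : L) * a ^ l)]
    simp only [zsmul_eq_mul] at h1
    exact eq_neg_of_add_eq_zero_right h1
  refine ⟨r + 1, 1 + ∑ l : Fin (r + 1), (f.coeff l).natAbs, by omega, by omega, fun k => ?_⟩
  set B : ℕ := 1 + ∑ l : Fin (r + 1), (f.coeff l).natAbs with hB
  have hfB : ∀ l : Fin (r + 1), 1 + |f.coeff l| ≤ (B : ℤ) := by
    intro l
    have := Finset.single_le_sum (f := fun l : Fin (r + 1) => (f.coeff l).natAbs)
      (fun _ _ => Nat.zero_le _) (Finset.mem_univ l)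
    rw [Int.abs_eq_natAbs]
    omega
  induction k with
  | zero =>
    refine ⟨Fin.cons 1 0, ?_, ?_⟩
    · intro l
      refine Fin.cases ?_ (fun l => ?_) l <;> simp
    · simp [Fin.sum_univ_succ]
  | succ k ih =>
    obtain ⟨A, hA, hAk⟩ := ih
    let A' : Fin (r + 1) → ℤ := Fin.cons 0 fun l => A l.castSucc
    have hA' : ∀ l, |A' l| ≤ (B : ℤ) ^ k := by
      intro l
      refine Fin.cases ?_ (fun l => ?_) l
      · simp [A']
      · simpa [A'] using hA l.castSucc
    refine ⟨fun l => A' l - A (Fin.last r) * f.coeff l, fun l => ?_, ?_⟩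
    · calc |A' l - A (Fin.last r) * f.coeff l|
          ≤ |A' l| + |A (Fin.last r)| * |f.coeff l| := by
            rw [← abs_mul]; exact abs_sub _ _
        _ ≤ (B : ℤ) ^ k + (B : ℤ) ^ k * |f.coeff l| := by
            gcongr
            · exact hA' l
            · exact hA _
        _ = (B : ℤ) ^ k * (1 + |f.coeff l|) := by ring
        _ ≤ (B : ℤ) ^ k * B := by gcongr; exact hfB l
        _ = _ := by rw [pow_succ]
    · have h1 : ∑ l, (A' l : L) * a ^ (l : ℕ) =
          ∑ l : Fin r, (A l.castSucc : L) * a ^ ((l : ℕ) + 1) := by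
        rw [Fin.sum_univ_succ]
        simp [A']
      rw [pow_succ, hAk, Fin.sum_univ_castSucc, add_mul, Finset.sum_mul]
      push_cast
      simp only [sub_mul, Finset.sum_sub_distrib, h1, mul_assoc, ← Finset.mul_sum, ← pow_succ]
      rw [hpow]
      simp only [Fin.val_castSucc]
      ring

/-- Use `exp y ≤ 1 + y + y²` for `|y| ≤ 1`; the linear terms cancel by symmetry about `1/2`. -/
theorem sum_exp_le {d : ℕ} (hd : 0 < d) {δ : ℝ} (hδ : 0 ≤ δ) (hδ1 : δ ≤ 1) :
    ∑ i : Fin (d + 1), Real.exp (2 * δ * (1 / 2 - (i : ℕ) / d)) ≤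
      (d + 1) * Real.exp (δ ^ 2) := by
  have hd' : (0 : ℝ) < d := by exact_mod_cast hd
  have h1 : ∀ i : Fin (d + 1), Real.exp (2 * δ * (1 / 2 - (i : ℕ) / d)) ≤
      1 + δ ^ 2 + 2 * δ * (1 / 2 - (i : ℕ) / d) := by
    intro i
    have hi : ((i : ℕ) : ℝ) / d ≤ 1 := by
      rw [div_le_one hd']; exact_mod_cast Nat.lt_succ_iff.1 i.2
    have hi0 : 0 ≤ ((i : ℕ) : ℝ) / d := by positivity
    set y := 2 * δ * (1 / 2 - ((i : ℕ) : ℝ) / d) with hy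
    have hyabs : |y| ≤ δ := by
      rw [abs_le]; constructor <;> nlinarith
    have h2 := (abs_le.1 (Real.abs_exp_sub_one_sub_id_le (hyabs.trans hδ1))).2
    have h3 : y ^ 2 ≤ δ ^ 2 := by
      rw [← sq_abs]; gcongr
    linarith
  have h0 : ∑ i : Fin (d + 1), (1 / 2 - ((i : ℕ) : ℝ) / d) = 0 := by
    rw [Finset.sum_sub_distrib, ← Finset.sum_div Finset.univ fun i : Fin (d + 1) => ((i : ℕ) : ℝ),
      Fin.sum_univ_eq_sum_range (fun i => (i : ℝ))]
    have h4 := Finset.sum_range_id_mul_two (d + 1)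
    rw [Nat.add_sub_cancel] at h4
    have h5 : (∑ i ∈ Finset.range (d + 1), (i : ℝ)) * 2 = (d + 1) * d := by
      have h6 := congrArg (Nat.cast (R := ℝ)) h4
      push_cast at h6
      exact h6
    have h6 : (∑ i ∈ Finset.range (d + 1), (i : ℝ)) = (d + 1) * d / 2 := by linarith
    rw [h6]
    simp
    field_simp
    ring
  refine (Finset.sum_le_sum fun i _ => h1 i).trans ?_
  rw [Finset.sum_add_distrib, ← Finset.mul_sum, h0, mul_zero, add_zero, Finset.sum_const,
    Finset.card_univ, Fintype.card_fin, nsmul_eq_mul]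
  push_cast
  gcongr
  linarith [Real.add_one_le_exp (δ ^ 2)]

/-- Few exponents in a box have weight much smaller than the average. -/
theorem card_small_weight_le {m : ℕ} (d : Fin m → ℕ) (hd : ∀ j, 0 < d j) {δ : ℝ} (hδ : 0 < δ)
    (hδ1 : δ ≤ 1) :
    (Fintype.card {J : ∀ j, Fin (d j + 1) //
      ∑ j, ((J j : ℕ) : ℝ) / d j < m * (1 / 2 - δ)} : ℝ) ≤
      Real.exp (-(m * δ ^ 2)) * ∏ j, ((d j : ℝ) + 1) := by
  classical
  rw [Fintype.card_subtype]
  set S := Finset.univ.filter fun J : ∀ j, Fin (d j + 1) =>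
    ∑ j, ((J j : ℕ) : ℝ) / d j < m * (1 / 2 - δ) with hS
  -- Exponential Markov inequality: each counted `J` has `∑ (1/2 - J j / d j) > mδ`, and the sum
  -- over the whole box factors by coordinates.
  have h1 : (S.card : ℝ) * Real.exp (2 * (m * δ ^ 2)) ≤
      Real.exp (m * δ ^ 2) * ∏ j, ((d j : ℝ) + 1) := by
    calc (S.card : ℝ) * Real.exp (2 * (m * δ ^ 2))
        = ∑ _J ∈ S, Real.exp (2 * (m * δ ^ 2)) := by rw [Finset.sum_const, nsmul_eq_mul]
      _ ≤ ∑ J ∈ S, ∏ j, Real.exp (2 * δ * (1 / 2 - (J j : ℕ) / d j)) := by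
          refine Finset.sum_le_sum fun J hJ => ?_
          rw [← Real.exp_sum, Real.exp_le_exp, ← Finset.mul_sum, Finset.sum_sub_distrib]
          have h2 := (Finset.mem_filter.1 hJ).2
          simp only [Finset.sum_const, Finset.card_univ, Fintype.card_fin, nsmul_eq_mul]
          nlinarith
      _ ≤ ∑ J : ∀ j, Fin (d j + 1), ∏ j, Real.exp (2 * δ * (1 / 2 - (J j : ℕ) / d j)) :=
          Finset.sum_le_sum_of_subset_of_nonneg (Finset.subset_univ _) fun _ _ _ => by positivity
      _ = ∏ j, ∑ i : Fin (d j + 1), Real.exp (2 * δ * (1 / 2 - (i : ℕ) / d j)) := by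
          rw [Finset.prod_univ_sum, Fintype.piFinset_univ]
      _ ≤ ∏ j, (((d j : ℝ) + 1) * Real.exp (δ ^ 2)) :=
          Finset.prod_le_prod (fun _ _ => by positivity) fun j _ => sum_exp_le (hd j) hδ.le hδ1
      _ = _ := by
          rw [Finset.prod_mul_distrib, Finset.prod_const, Finset.card_univ, Fintype.card_fin,
            ← Real.exp_nat_mul, mul_comm]
  have h3 : Real.exp (m * δ ^ 2) = Real.exp (-(m * δ ^ 2)) * Real.exp (2 * (m * δ ^ 2)) := by
    rw [← Real.exp_add]; ring_nf
  rw [h3] at h1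
  refine le_of_mul_le_mul_right (h1.trans_eq ?_) (Real.exp_pos (2 * (m * δ ^ 2)))
  ring

/-- The exponent given by a point of a box. -/
noncomputable def boxExponent {m : ℕ} {d : Fin m → ℕ} (J : ∀ j, Fin (d j + 1)) : Fin m →₀ ℕ :=
  Finsupp.equivFunOnFinite.symm fun j => (J j : ℕ)

theorem boxExponent_injective {m : ℕ} {d : Fin m → ℕ} :
    Function.Injective (boxExponent (d := d)) := by
  intro J J' h
  ext j
  exact DFunLike.congr_fun h j

theorem card_box_le {m : ℕ} (d : Fin m → ℕ) :
    Fintype.card (∀ j, Fin (d j + 1)) ≤ 2 ^ ∑ j, d j := by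
  rw [Fintype.card_pi, ← Finset.prod_pow_eq_pow_sum]
  exact Finset.prod_le_prod' fun j _ => by rw [Fintype.card_fin]; exact Nat.lt_two_pow_self

/-- If `a = c α` satisfies the relations `a ^ q = ∑ l, A q l * a ^ l`, a solution of a linear
system with integer coefficients gives a polynomial whose Taylor coefficient of order `J` at
`(α, …, α)` vanishes. -/
theorem coeff_translate_eq_zero {L : Type*} [Field L] [CharZero L] {m r c : ℕ} (hc : c ≠ 0)
    {α : L} {A : ℕ → Fin r → ℤ}
    (hA : ∀ q, ((c : L) * α) ^ q = ∑ l, (A q l : L) * ((c : L) * α) ^ (l : ℕ))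
    (d : Fin m → ℕ) (t : (∀ j, Fin (d j + 1)) → ℤ) (J : Fin m →₀ ℕ)
    (ht : ∀ l, ∑ e : ∀ j, Fin (d j + 1), ((multiChoose (boxExponent e) J : ℤ) *
      ((c : ℤ) ^ (∑ j, d j - (∑ j, (e j : ℕ) - ∑ j, J j)) *
        A (∑ j, (e j : ℕ) - ∑ j, J j) l)) * t e = 0) :
    coeff J (translate (fun _ => α) (∑ e, monomial (boxExponent e) (t e))) = 0 := by
  have hcL : (c : L) ≠ 0 := Nat.cast_ne_zero.2 hc
  have h1 : (c : L) ^ (∑ j, d j) *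
      coeff J (translate (fun _ => α) (∑ e, monomial (boxExponent e) (t e))) =
      ∑ l : Fin r, ((∑ e : ∀ j, Fin (d j + 1), ((multiChoose (boxExponent e) J : ℤ) *
      ((c : ℤ) ^ (∑ j, d j - (∑ j, (e j : ℕ) - ∑ j, J j)) *
        A (∑ j, (e j : ℕ) - ∑ j, J j) l)) * t e : ℤ) : L) * ((c : L) * α) ^ (l : ℕ) := by
    rw [map_sum, coeff_sum, Finset.mul_sum]
    push_cast
    simp_rw [Finset.sum_mul]
    rw [Finset.sum_comm]
    refine Finset.sum_congr rfl fun e _ => ?_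
    rw [coeff_translate_monomial, Finset.prod_pow_eq_pow_sum]
    -- The truncated subtractions are genuine when `J ≤ e`; otherwise the binomial factor is zero.
    by_cases hJ : J ≤ boxExponent e
    · have h2 : ∑ j, (boxExponent e j - J j) = ∑ j, (e j : ℕ) - ∑ j, J j :=
        Finset.sum_tsub_distrib _ fun j _ => hJ j
      have h3 : ∑ j, (e j : ℕ) - ∑ j, J j ≤ ∑ j, d j :=
        (Nat.sub_le _ _).trans (Finset.sum_le_sum fun j _ => Nat.lt_succ_iff.1 (e j).2)
      rw [h2]
      set q := ∑ j, (e j : ℕ) - ∑ j, J j with hq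
      have h4 : (c : L) ^ (∑ j, d j) * α ^ q = c ^ (∑ j, d j - q) * ((c : L) * α) ^ q := by
        rw [mul_pow, ← mul_assoc, ← pow_add, Nat.sub_add_cancel h3]
      calc (c : L) ^ (∑ j, d j) * (algebraMap ℤ L (t e) *
            ((multiChoose (boxExponent e) J : L) * α ^ q))
          = (multiChoose (boxExponent e) J : L) * t e * ((c : L) ^ (∑ j, d j) * α ^ q) := by
            rw [algebraMap_int_eq, eq_intCast]; ring
        _ = _ := by
            rw [h4, hA, Finset.mul_sum, Finset.mul_sum]
            exact Finset.sum_congr rfl fun l _ => by ring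
    · rw [multiChoose_eq_zero hJ]
      simp
  simp only [ht, Int.cast_zero, zero_mul, Finset.sum_const_zero] at h1
  exact (mul_eq_zero.1 h1).resolve_left (pow_ne_zero _ hcL)

/-- The auxiliary polynomial: small integer coefficients and large index at `(α, …, α)`. -/
theorem exists_auxiliary_polynomial {L : Type*} [Field L] [CharZero L] {α : L}
    (hα : IsAlgebraic ℤ α) {δ : ℝ} (hδ : 0 < δ) (hδ1 : δ < 1 / 2) :
    ∃ (m : ℕ) (C : ℝ), 0 < m ∧ 1 ≤ C ∧ ∀ d : Fin m → ℕ, (∀ j, 0 < d j) →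
      ∃ P : MvPolynomial (Fin m) ℤ, P ≠ 0 ∧ (∀ j, degreeOf j P ≤ d j) ∧
        l1 intAbv P ≤ C ^ (∑ j, d j) ∧
        SuppGE (wt d) (m * (1 / 2 - δ)) (translate (fun _ => α) P) := by
  classical
  obtain ⟨y, hy, hint⟩ := hα.exists_integral_multiple
  have hint' : IsIntegral ℤ ((y.natAbs : L) * α) := by
    rcases Int.natAbs_eq y with h | h
    · rwa [h, zsmul_eq_mul, Int.cast_natCast] at hint
    · rw [h, zsmul_eq_mul, Int.cast_neg, Int.cast_natCast, neg_mul] at hint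
      simpa using hint.neg
  set c := y.natAbs with hc
  have hc0 : c ≠ 0 := Int.natAbs_ne_zero.2 hy
  obtain ⟨r, B, hr, hB, hpow⟩ := exists_pow_eq_sum hint'
  choose A hAle hA using hpow
  -- Each vanishing Taylor coefficient costs `r` integer equations; this `m` makes `2r·exp(-mδ²) ≤
  -- 1`, leaving twice as many unknowns as equations.
  obtain ⟨m, hm⟩ := exists_nat_gt (Real.log (2 * r) / δ ^ 2)
  have hr1 : (1 : ℝ) ≤ r := by exact_mod_cast hr
  have hm0 : 0 < m := by
    have : 0 ≤ Real.log (2 * r) / δ ^ 2 := div_nonneg (Real.log_nonneg (by linarith)) (by positivity)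
    exact_mod_cast this.trans_lt hm
  have hexp : 2 * r * Real.exp (-(m * δ ^ 2)) ≤ 1 := by
    rw [div_lt_iff₀ (by positivity)] at hm
    have h1 := Real.exp_le_exp.2 hm.le
    rw [Real.exp_log (by linarith)] at h1
    rw [Real.exp_neg, ← div_eq_mul_inv, div_le_one (Real.exp_pos _)]
    exact h1
  have hcB : (1 : ℝ) ≤ (2 * c * B : ℕ) := by
    have : 1 ≤ c := Nat.one_le_iff_ne_zero.2 hc0
    have h2 : 1 ≤ 2 * c * B := Nat.one_le_iff_ne_zero.2 (by positivity)
    exact_mod_cast h2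
  -- Matrix entries are at most `(2cB)^D` with `D = ∑ d j`. The two further factors 2 come from the
  -- number of unknowns in Siegel's bound and from summing over the monomials.
  refine ⟨m, 2 * 2 * (2 * c * B : ℕ), hm0, by linarith, fun d hd => ?_⟩
  let Box := ∀ j, Fin (d j + 1)
  let Bad := {J : Box // ∑ j, ((J j : ℕ) : ℝ) / d j < m * (1 / 2 - δ)}
  let M : Matrix (Bad × Fin r) Box ℤ := Matrix.of fun i e =>
    (multiChoose (boxExponent e) (boxExponent i.1.1) : ℤ) *
      ((c : ℤ) ^ (∑ j, d j - (∑ j, (e j : ℕ) - ∑ j, boxExponent i.1.1 j)) *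
        A (∑ j, (e j : ℕ) - ∑ j, boxExponent i.1.1 j) i.2)
  have hmR : (0 : ℝ) < m := by exact_mod_cast hm0
  have hcard0 : 0 < Fintype.card (Bad × Fin r) := by
    have : Nonempty Bad := ⟨⟨fun _ => 0, by
      simp only [Fin.val_zero, Nat.cast_zero, zero_div, Finset.sum_const_zero]
      exact mul_pos hmR (by linarith)⟩⟩
    have : Nonempty (Fin r) := ⟨⟨0, hr⟩⟩
    exact Fintype.card_pos
  have hcard : 2 * Fintype.card (Bad × Fin r) ≤ Fintype.card Box := by
    have h1 := card_small_weight_le d hd hδ (by linarith)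
    have h2 : (Fintype.card Box : ℝ) = ∏ j, ((d j : ℝ) + 1) := by
      simp [Box, Fintype.card_pi]
    rw [← h2] at h1
    have h3 : (2 * Fintype.card (Bad × Fin r) : ℝ) ≤ Fintype.card Box := by
      rw [Fintype.card_prod, Fintype.card_fin]
      push_cast
      calc 2 * ((Fintype.card Bad : ℝ) * r)
          ≤ 2 * ((Real.exp (-(m * δ ^ 2)) * Fintype.card Box) * r) := by gcongr
        _ = (2 * r * Real.exp (-(m * δ ^ 2))) * Fintype.card Box := by ring
        _ ≤ 1 * Fintype.card Box := by gcongr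
        _ = _ := one_mul _
    exact_mod_cast h3
  set D := ∑ j, d j with hD
  have hMle : ∀ i e, |(M i e : ℝ)| ≤ ((2 * c * B : ℕ) : ℝ) ^ D := by
    intro i e
    have he : ∑ j, (e j : ℕ) ≤ D := Finset.sum_le_sum fun j _ => Nat.lt_succ_iff.1 (e j).2
    have h1 : |M i e| ≤ ((2 * c * B : ℕ) : ℤ) ^ D := by
      simp only [M, Matrix.of_apply]
      set q := ∑ j, (e j : ℕ) - ∑ j, boxExponent i.1.1 j with hq
      have hqD : q ≤ D := (Nat.sub_le _ _).trans he
      rw [abs_mul, abs_mul, Nat.abs_cast, abs_pow, Nat.abs_cast]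
      have h2 : (multiChoose (boxExponent e) (boxExponent i.1.1) : ℤ) ≤ 2 ^ D := by
        have := (multiChoose_le (boxExponent e) (boxExponent i.1.1)).trans
          (Nat.pow_le_pow_right two_pos he)
        exact_mod_cast this
      have h3 : (c : ℤ) ^ (D - q) ≤ (c : ℤ) ^ D :=
        pow_le_pow_right₀ (by exact_mod_cast Nat.one_le_iff_ne_zero.2 hc0) (Nat.sub_le _ _)
      have h4 : |A q i.2| ≤ (B : ℤ) ^ D :=
        (hAle q i.2).trans (pow_le_pow_right₀ (by exact_mod_cast hB) hqD)
      calc _ ≤ (2 : ℤ) ^ D * ((c : ℤ) ^ D * (B : ℤ) ^ D) := by gcongr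
        _ = _ := by push_cast; rw [mul_pow, mul_pow]; ring
    exact_mod_cast h1
  obtain ⟨t, ht0, ht, htle⟩ := exists_small_int_solution M hcard0 hcard
    (one_le_pow₀ hcB) hMle
  set P : MvPolynomial (Fin m) ℤ := ∑ e : Box, monomial (boxExponent e) (t e) with hP
  have hcoeff : ∀ e : Box, coeff (boxExponent e) P = t e := by
    intro e
    rw [hP, coeff_sum]
    rw [Finset.sum_eq_single e, coeff_monomial, if_pos rfl]
    · intro e' _ hne
      rw [coeff_monomial, if_neg (boxExponent_injective.ne hne)]
    · simp
  have hdeg : ∀ j, degreeOf j P ≤ d j := by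
    intro j
    rw [degreeOf_le_iff]
    intro e he
    rw [mem_support_iff, hP, coeff_sum] at he
    obtain ⟨e', -, hne⟩ := Finset.exists_ne_zero_of_sum_ne_zero he
    rw [coeff_monomial] at hne
    have : boxExponent e' = e := by by_contra h; simp [h] at hne
    rw [← this]
    exact Nat.lt_succ_iff.1 (e' j).2
  refine ⟨P, ?_, hdeg, ?_, ?_⟩
  · obtain ⟨e, he⟩ := Function.ne_iff.1 ht0
    intro h
    apply he
    rw [← hcoeff, h, coeff_zero]
    rfl
  · have hbox : (Fintype.card Box : ℝ) ≤ 2 ^ D := by exact_mod_cast card_box_le d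
    calc l1 intAbv P ≤ ∑ e : Box, l1 intAbv (monomial (boxExponent e) (t e)) := l1_sum_le _ _ _
      _ ≤ ∑ _e : Box, (Fintype.card Box : ℝ) * ((2 * c * B : ℕ) : ℝ) ^ D := by
          refine Finset.sum_le_sum fun e _ => ?_
          rw [l1_monomial, intAbv_apply]
          exact htle e
      _ = Fintype.card Box * (Fintype.card Box * ((2 * c * B : ℕ) : ℝ) ^ D) := by
          rw [Finset.sum_const, nsmul_eq_mul, Finset.card_univ]
      _ ≤ 2 ^ D * (2 ^ D * ((2 * c * B : ℕ) : ℝ) ^ D) := by gcongr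
      _ = _ := by rw [mul_pow, mul_pow]; ring
  · intro J hJ
    by_contra hlt
    rw [not_le] at hlt
    have hJd : ∀ j, J j < d j + 1 := fun j => Nat.lt_succ_iff.2
      (degreeOf_le_iff.1 ((degreeOf_translate_le P _ j).trans (hdeg j)) J (mem_support_iff.2 hJ))
    let J' : Box := fun j => ⟨J j, hJd j⟩
    have hJJ : boxExponent J' = J := by ext j; rfl
    have hbad : ∑ j, ((J' j : ℕ) : ℝ) / d j < m * (1 / 2 - δ) := hlt
    refine hJ (coeff_translate_eq_zero hc0 hA d t J fun l => ?_)
    have h1 := congrFun ht (⟨J', hbad⟩, l)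
    simp only [Matrix.mulVec, dotProduct, M, Matrix.of_apply, hJJ, Pi.zero_apply] at h1
    exact h1

end Auxiliary

end Roth

namespace Roth

open MvPolynomial NumberField Height

/-! ### Normalized absolute values and heights. -/

section Places

variable {K : Type*} [Field K] [NumberField K]

theorem finprod_place (f : Place K → ℝ) (hf : f.HasFiniteMulSupport) :
    ∏ᶠ v, f v = (∏ v : InfinitePlace K, f (.inl v)) * ∏ᶠ v : FinitePlace K, f (.inr v) := by
  rw [← finprod_mem_univ, ← Set.range_inl_union_range_inr,
    finprod_mem_union' Set.isCompl_range_inl_range_inr.disjoint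
      (Set.Finite.inter_of_right hf _) (Set.Finite.inter_of_right hf _),
    finprod_mem_range Sum.inl_injective, finprod_mem_range Sum.inr_injective,
    finprod_eq_prod_of_fintype]

theorem finrank_pos_real : (0 : ℝ) < (Module.finrank ℚ K : ℝ) := by
  exact_mod_cast (Module.finrank_pos (R := ℚ) (M := K))

theorem normAbs_nonneg (v : Place K) (x : K) : 0 ≤ normAbs v x := by
  rcases v with v | v
  · exact Real.rpow_nonneg (apply_nonneg v x) _
  · exact Real.rpow_nonneg (apply_nonneg v x) _

theorem max_one_rpow {x p : ℝ} (hx : 0 ≤ x) (hp : 0 ≤ p) : max 1 (x ^ p) = max 1 x ^ p := by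
  rcases le_total 1 x with h | h
  · rw [max_eq_right h, max_eq_right (Real.one_le_rpow h hp)]
  · rw [max_eq_left h, max_eq_left (Real.rpow_le_one hx h hp), Real.one_rpow]

theorem rpow_div_pow_finrank {x : ℝ} (hx : 0 ≤ x) (n : ℕ) :
    (x ^ ((n : ℝ) / (Module.finrank ℚ K : ℝ))) ^ Module.finrank ℚ K = x ^ n := by
  rw [← Real.rpow_natCast, ← Real.rpow_mul hx, div_mul_cancel₀ _ finrank_pos_real.ne',
    Real.rpow_natCast]

theorem normAbs_hasFiniteMulSupport {x : K} (hx : x ≠ 0) :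
    (fun v : Place K => normAbs v x).HasFiniteMulSupport := by
  refine ((Set.finite_range (Sum.inl : InfinitePlace K → Place K)).union
    (Set.Finite.image Sum.inr (FinitePlace.hasFiniteMulSupport (K := K) hx))).subset ?_
  rintro (v | v) hv
  · exact Or.inl ⟨v, rfl⟩
  · refine Or.inr ⟨v, fun h1 => hv ?_, rfl⟩
    have h2 : v x = 1 := h1
    simp [normAbs, h2]

theorem finprod_normAbs_eq_one {x : K} (hx : x ≠ 0) : ∏ᶠ v : Place K, normAbs v x = 1 := by
  have hf := normAbs_hasFiniteMulSupport hx
  have h0 : 0 ≤ ∏ᶠ v : Place K, normAbs v x := finprod_nonneg fun v => normAbs_nonneg v x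
  refine (pow_eq_one_iff_of_nonneg h0 (Module.finrank_pos (R := ℚ) (M := K)).ne').1 ?_
  have hfp : (fun v : Place K => normAbs v x ^ Module.finrank ℚ K).HasFiniteMulSupport :=
    hf.pow _
  rw [finprod_pow hf, finprod_place _ hfp, ← prod_abs_eq_one hx]
  congr 1
  · exact Finset.prod_congr rfl fun v _ => rpow_div_pow_finrank (apply_nonneg v x) _
  · refine finprod_congr fun v => ?_
    have := rpow_div_pow_finrank (K := K) (apply_nonneg v x) 1
    simpa [normAbs] using this

/-- The power undoes the exponents `1/[K:ℚ]`; `mulHeight₁` is the height relative to `K`. -/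
theorem height_pow_finrank (x : K) : height x ^ Module.finrank ℚ K = mulHeight₁ x := by
  have hf : (fun v : Place K => max 1 (normAbs v x)).HasFiniteMulSupport :=
    height_finite_mulSupport x
  have hfp : (fun v : Place K => max 1 (normAbs v x) ^ Module.finrank ℚ K).HasFiniteMulSupport :=
    hf.pow _
  rw [height, finprod_pow hf, finprod_place _ hfp, NumberField.mulHeight₁_eq]
  have hd := (finrank_pos_real (K := K)).le
  congr 1
  · refine Finset.prod_congr rfl fun v _ => ?_
    rw [normAbs, max_one_rpow (apply_nonneg v x) (by positivity),
      rpow_div_pow_finrank (by positivity), max_comm]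
  · refine finprod_congr fun v => ?_
    have := rpow_div_pow_finrank (K := K) (x := max 1 (v x)) (by positivity) 1
    rw [normAbs, max_one_rpow (apply_nonneg v x) (by positivity), max_comm (v x)]
    simpa using this

theorem one_le_height (x : K) : 1 ≤ height x :=
  one_le_finprod fun _ => le_max_left _ _

theorem finrank_mul_log_height (x : K) :
    Module.finrank ℚ K * Real.log (height x) = logHeight₁ x := by
  rw [← Real.log_pow, height_pow_finrank, logHeight₁_eq_log_mulHeight₁]

/-- Northcott's theorem. -/
theorem finite_log_height_le (B : ℝ) : {x : K | Real.log (height x) ≤ B}.Finite := by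
  refine (finite_setOfPred_logHeight₁_le (K := K) (Module.finrank ℚ K * B)).subset fun x hx => ?_
  change logHeight₁ x ≤ _
  rw [← finrank_mul_log_height]
  exact mul_le_mul_of_nonneg_left hx finrank_pos_real.le

end Places

/-! ### Local estimates for polynomial values. -/

section Local

variable {m : ℕ} {d : Fin m → ℕ} {Q : MvPolynomial (Fin m) ℤ}

theorem aeval_eq_sum_intCast {A : Type*} [CommRing A] (x : Fin m → A)
    (Q : MvPolynomial (Fin m) ℤ) :
    aeval x Q = ∑ e ∈ Q.support, ((coeff e Q : ℤ) : A) * ∏ j, x j ^ e j := by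
  rw [aeval_def, eval₂_eq']
  rfl

theorem prod_pow_le_prod_max_pow {ι : Type*} (s : Finset ι) {y : ι → ℝ} (hy : ∀ j, 0 ≤ y j)
    {e d : ι → ℕ} (he : ∀ j, e j ≤ d j) : ∏ j ∈ s, y j ^ e j ≤ ∏ j ∈ s, max 1 (y j) ^ d j := by
  refine Finset.prod_le_prod (fun j _ => pow_nonneg (hy j) _) fun j _ => ?_
  exact (pow_le_pow_left₀ (hy j) (le_max_right _ _) _).trans
    (pow_le_pow_right₀ (le_max_left _ _) (he j))

theorem abv_aeval_le {A : Type*} [Field A] (w : AbsoluteValue A ℝ) (x : Fin m → A)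
    (hd : ∀ j, degreeOf j Q ≤ d j) :
    w (aeval x Q) ≤ l1 intAbv Q * ∏ j, max 1 (w (x j)) ^ d j := by
  rw [aeval_eq_sum_intCast, l1, Finset.sum_mul]
  refine (w.sum_le _ _).trans (Finset.sum_le_sum fun e he => ?_)
  rw [map_mul, map_prod]
  simp only [map_pow]
  exact mul_le_mul (abv_intCast_le w _) (prod_pow_le_prod_max_pow _ (fun j => w.nonneg _)
    fun j => degreeOf_le_iff.1 (hd j) e he) (Finset.prod_nonneg fun j _ => by positivity)
    (intAbv.nonneg _)

/-- Integer coefficients and the ultrametric inequality leave no constant, so constants occur at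
only finitely many places. -/
theorem finitePlace_aeval_le {K : Type*} [Field K] [NumberField K] (v : FinitePlace K)
    (x : Fin m → K) (hd : ∀ j, degreeOf j Q ≤ d j) :
    v (aeval x Q) ≤ ∏ j, max 1 (v (x j)) ^ d j := by
  have hsum : ∀ (s : Finset (Fin m →₀ ℕ)) (f : (Fin m →₀ ℕ) → K) (B : ℝ), 0 ≤ B →
      (∀ e ∈ s, v (f e) ≤ B) → v (∑ e ∈ s, f e) ≤ B := by
    classical
    intro s f B hB h
    induction s using Finset.induction_on with
    | empty => simpa using hB
    | insert a s ha ih =>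
      rw [Finset.sum_insert ha]
      exact (FinitePlace.add_le v _ _).trans (max_le (h a (Finset.mem_insert_self _ _))
        (ih fun e he => h e (Finset.mem_insert_of_mem he)))
  rw [aeval_eq_sum_intCast]
  refine hsum _ _ _ (Finset.prod_nonneg fun j _ => by positivity) fun e he => ?_
  rw [map_mul, map_prod]
  simp only [map_pow]
  have h1 := prod_pow_le_prod_max_pow Finset.univ (fun j => apply_nonneg v (x j))
    fun j => degreeOf_le_iff.1 (hd j) e he
  refine (mul_le_of_le_one_left (Finset.prod_nonneg fun j _ => ?_)
    (finitePlace_intCast_le_one v _)).trans h1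
  exact pow_nonneg (apply_nonneg v _) _

theorem normAbs_inl_aeval_le {K : Type*} [Field K] [NumberField K] (v : InfinitePlace K)
    (x : Fin m → K) (hQ : Q ≠ 0) (hd : ∀ j, degreeOf j Q ≤ d j) :
    normAbs (.inl v) (aeval x Q) ≤
      l1 intAbv Q * ∏ j, max 1 (normAbs (.inl v) (x j)) ^ d j := by
  set p : ℝ := (v.mult : ℝ) / (Module.finrank ℚ K : ℝ) with hp
  have hN := finrank_pos_real (K := K)
  have hp0 : 0 ≤ p := by positivity
  -- With `p ≤ 1` and `l1 ≥ 1`, the factor `l1 ^ p` can be replaced by `l1`.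
  have hp1 : p ≤ 1 := by
    rw [hp, div_le_one hN, ← InfinitePlace.sum_mult_eq (K := K)]
    exact_mod_cast Finset.single_le_sum (f := fun v : InfinitePlace K => v.mult)
      (fun _ _ => Nat.zero_le _) (Finset.mem_univ v)
  have h1 : v (aeval x Q) ≤ l1 intAbv Q * ∏ j, max 1 (v (x j)) ^ d j :=
    abv_aeval_le v.val x hd
  have hl := one_le_l1 hQ
  calc normAbs (.inl v) (aeval x Q) = v (aeval x Q) ^ p := rfl
    _ ≤ (l1 intAbv Q * ∏ j, max 1 (v (x j)) ^ d j) ^ p :=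
        Real.rpow_le_rpow (apply_nonneg v _) h1 hp0
    _ = l1 intAbv Q ^ p * ∏ j, max 1 (normAbs (.inl v) (x j)) ^ d j := by
        rw [Real.mul_rpow (by linarith) (Finset.prod_nonneg fun j _ => by positivity),
          ← Real.finsetProd_rpow _ _ fun j _ => by positivity]
        congr 1
        refine Finset.prod_congr rfl fun j _ => ?_
        rw [normAbs, max_one_rpow (apply_nonneg v _) hp0, ← Real.rpow_natCast,
          ← Real.rpow_natCast, ← Real.rpow_mul (by positivity), ← Real.rpow_mul (by positivity),
          mul_comm]
    _ ≤ _ := by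
        refine mul_le_mul_of_nonneg_right ?_ (Finset.prod_nonneg fun j _ => by positivity)
        exact (Real.rpow_le_rpow_of_exponent_le hl hp1).trans_eq (Real.rpow_one _)

theorem normAbs_inr_aeval_le {K : Type*} [Field K] [NumberField K] (v : FinitePlace K)
    (x : Fin m → K) (hd : ∀ j, degreeOf j Q ≤ d j) :
    normAbs (.inr v) (aeval x Q) ≤ ∏ j, max 1 (normAbs (.inr v) (x j)) ^ d j := by
  set p : ℝ := 1 / (Module.finrank ℚ K : ℝ) with hp
  have hN := finrank_pos_real (K := K)
  have hp0 : 0 ≤ p := by positivity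
  calc normAbs (.inr v) (aeval x Q) = v (aeval x Q) ^ p := rfl
    _ ≤ (∏ j, max 1 (v (x j)) ^ d j) ^ p :=
        Real.rpow_le_rpow (apply_nonneg v _) (finitePlace_aeval_le v x hd) hp0
    _ = ∏ j, max 1 (normAbs (.inr v) (x j)) ^ d j := by
        rw [← Real.finsetProd_rpow _ _ fun j _ => by positivity]
        refine Finset.prod_congr rfl fun j _ => ?_
        rw [normAbs, max_one_rpow (apply_nonneg v _) hp0, ← Real.rpow_natCast,
          ← Real.rpow_natCast, ← Real.rpow_mul (by positivity), ← Real.rpow_mul (by positivity),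
          mul_comm]

/-- The value of a polynomial of large index at `(α, …, α)` is small near `α`. -/
theorem abv_aeval_le_of_suppGE {A : Type*} [Field A] (w : AbsoluteValue A ℝ) (x : Fin m → A)
    (α : A) (hd : ∀ j, degreeOf j Q ≤ d j) {t E : ℝ}
    (ht : SuppGE (wt d) t (translate (fun _ => α) Q)) (hE0 : 0 ≤ E)
    (hE : ∀ J : Fin m →₀ ℕ, t ≤ wt d J → ∏ j, min 1 (w (x j - α)) ^ J j ≤ E) :
    w (aeval x Q) ≤
      l1 intAbv Q * ((1 + w α) ^ (2 * ∑ j, d j) * E) * ∏ j, max 1 (w (x j)) ^ d j := by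
  have hα : 0 ≤ w α := w.nonneg α
  set D := ∑ j, d j with hD
  have hterm : ∀ J ∈ (translate (fun _ => α) Q).support,
      ∏ j, w (x j - α) ^ J j ≤ E * ((1 + w α) ^ D * ∏ j, max 1 (w (x j)) ^ d j) := by
    intro J hJ
    have hJd : ∀ j, J j ≤ d j := fun j =>
      degreeOf_le_iff.1 ((degreeOf_translate_le Q _ j).trans (hd j)) J hJ
    -- Split `y = min(1,y)·max(1,y)`: the minimum carries the approximation, and the maximum is
    -- absorbed into the height factor.
    have h1 : ∀ j, w (x j - α) ^ J j ≤
        min 1 (w (x j - α)) ^ J j * ((1 + w α) ^ d j * max 1 (w (x j)) ^ d j) := by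
      intro j
      have h2 : max 1 (w (x j - α)) ≤ (1 + w α) * max 1 (w (x j)) := by
        have h3 : w (x j - α) ≤ w (x j) + w α := by
          rw [sub_eq_add_neg, ← w.map_neg α]; exact w.add_le _ _
        have h4 : 1 ≤ max 1 (w (x j)) := le_max_left _ _
        have h5 : w (x j) ≤ max 1 (w (x j)) := le_max_right _ _
        refine max_le ?_ ?_ <;> nlinarith
      calc w (x j - α) ^ J j = min 1 (w (x j - α)) ^ J j * max 1 (w (x j - α)) ^ J j := by
            rw [← mul_pow, min_mul_max, one_mul]
        _ ≤ min 1 (w (x j - α)) ^ J j * ((1 + w α) * max 1 (w (x j))) ^ d j := by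
            refine mul_le_mul_of_nonneg_left ?_ (pow_nonneg (le_min zero_le_one (w.nonneg _)) _)
            exact (pow_le_pow_right₀ (le_max_left _ _) (hJd j)).trans
              (pow_le_pow_left₀ (by positivity) h2 _)
        _ = _ := by rw [mul_pow]
    calc ∏ j, w (x j - α) ^ J j
        ≤ ∏ j, (min 1 (w (x j - α)) ^ J j * ((1 + w α) ^ d j * max 1 (w (x j)) ^ d j)) :=
          Finset.prod_le_prod (fun j _ => pow_nonneg (w.nonneg _) _) fun j _ => h1 j
      _ = (∏ j, min 1 (w (x j - α)) ^ J j) *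
            ((1 + w α) ^ D * ∏ j, max 1 (w (x j)) ^ d j) := by
          rw [Finset.prod_mul_distrib, Finset.prod_mul_distrib, Finset.prod_pow_eq_pow_sum]
      _ ≤ _ := by
          refine mul_le_mul_of_nonneg_right (hE J (ht J (mem_support_iff.1 hJ))) ?_
          exact mul_nonneg (by positivity) (Finset.prod_nonneg fun j _ => by positivity)
  have hl : l1 w (translate (fun _ => α) Q) ≤ l1 intAbv Q * (1 + w α) ^ D :=
    l1_translate_le w hd _ (by linarith) fun _ => le_rfl
  have hprod : 0 ≤ ∏ j, max 1 (w (x j)) ^ d j := Finset.prod_nonneg fun j _ => by positivity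
  rw [aeval_eq_sum_translate (fun _ => α) x Q]
  calc w (∑ J ∈ (translate (fun _ => α) Q).support,
        coeff J (translate (fun _ => α) Q) * ∏ j, (x j - α) ^ J j)
      ≤ ∑ J ∈ (translate (fun _ => α) Q).support, w (coeff J (translate (fun _ => α) Q)) *
          (E * ((1 + w α) ^ D * ∏ j, max 1 (w (x j)) ^ d j)) := by
        refine (w.sum_le _ _).trans (Finset.sum_le_sum fun J hJ => ?_)
        rw [map_mul, map_prod]
        simp only [map_pow]
        exact mul_le_mul_of_nonneg_left (hterm J hJ) (w.nonneg _)
    _ = l1 w (translate (fun _ => α) Q) *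
          (E * ((1 + w α) ^ D * ∏ j, max 1 (w (x j)) ^ d j)) := by
        rw [l1, Finset.sum_mul]
    _ ≤ (l1 intAbv Q * (1 + w α) ^ D) *
          (E * ((1 + w α) ^ D * ∏ j, max 1 (w (x j)) ^ d j)) := by
        refine mul_le_mul_of_nonneg_right hl (mul_nonneg hE0 (mul_nonneg (by positivity) hprod))
    _ = _ := by rw [two_mul, pow_add]; ring

end Local

/-! ### The product formula. -/

section Global

variable {K : Type*} [Field K] [NumberField K] {m : ℕ} {d : Fin m → ℕ}
  {Q : MvPolynomial (Fin m) ℤ}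

/-- The product formula for a non-zero value of an integer polynomial. -/
theorem one_le_of_aeval_ne_zero {L : Type*} [Field L] [Algebra K L] (S : Finset (Place K))
    (w : Place K → AbsoluteValue L ℝ) (hw : ∀ v ∈ S, Extends (w v) v) (α : L) (x : Fin m → K)
    (hd : ∀ j, degreeOf j Q ≤ d j) (hx : aeval x Q ≠ 0) {t : ℝ} {E : Place K → ℝ}
    (ht : SuppGE (wt d) t (translate (fun _ => α) Q)) (hE0 : ∀ v ∈ S, 0 ≤ E v)
    (hE : ∀ v ∈ S, ∀ J : Fin m →₀ ℕ, t ≤ wt d J →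
      ∏ j, min 1 (w v (algebraMap K L (x j) - α)) ^ J j ≤ E v) :
    1 ≤ l1 intAbv Q ^ (S.card + Fintype.card (InfinitePlace K)) *
      (∏ v ∈ S, ((1 + w v α) ^ (2 * ∑ j, d j) * E v)) * ∏ j, height (x j) ^ d j := by
  classical
  have hQ : Q ≠ 0 := fun h => hx (by rw [h, map_zero])
  have hl := one_le_l1 hQ
  set T : Finset (Place K) := S ∪ Finset.univ.image Sum.inl with hT
  -- The local bound is a product of three functions of finite multiplicative support: coefficient
  -- size on `S` and the archimedean places, the gain on `S`, and the heights.
  set B₁ : Place K → ℝ := fun v => if v ∈ T then l1 intAbv Q else 1 with hB₁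
  set B₂ : Place K → ℝ := fun v =>
    if v ∈ S then (1 + w v α) ^ (2 * ∑ j, d j) * E v else 1 with hB₂
  set H : Place K → ℝ := fun v => ∏ j, max 1 (normAbs v (x j)) ^ d j with hH
  have hH0 : ∀ v, 0 ≤ H v := fun v => Finset.prod_nonneg fun j _ => by positivity
  have hlocal : ∀ v, normAbs v (aeval x Q) ≤ B₁ v * B₂ v * H v := by
    intro v
    by_cases hv : v ∈ S
    · have hvT : v ∈ T := Finset.mem_union_left _ hv
      have h1 := abv_aeval_le_of_suppGE (w v) (fun j => algebraMap K L (x j)) α hd ht (hE0 v hv)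
        (hE v hv)
      have h2 : aeval (fun j => algebraMap K L (x j)) Q = algebraMap K L (aeval x Q) := by
        rw [aeval_eq_sum_intCast, aeval_eq_sum_intCast]
        simp
      rw [h2, hw v hv] at h1
      simp only [hw v hv _] at h1
      simp only [hB₁, hB₂, if_pos hv, if_pos hvT, hH]
      exact h1
    · simp only [hB₂, if_neg hv, mul_one]
      rcases v with v | v
      · have hvT : (Sum.inl v : Place K) ∈ T :=
          Finset.mem_union_right _ (Finset.mem_image_of_mem _ (Finset.mem_univ v))
        simp only [hB₁, if_pos hvT]
        exact normAbs_inl_aeval_le v x hQ hd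
      · have hvT : (Sum.inr v : Place K) ∉ T := by simp [hT, hv]
        simp only [hB₁, if_neg hvT, one_mul]
        exact normAbs_inr_aeval_le v x hd
  have hsub₁ : Function.mulSupport B₁ ⊆ (T : Set (Place K)) := by
    intro v hv
    by_contra h
    exact hv (if_neg h)
  have hsub₂ : Function.mulSupport B₂ ⊆ (S : Set (Place K)) := by
    intro v hv
    by_contra h
    exact hv (if_neg h)
  have hf₁ : B₁.HasFiniteMulSupport := T.finite_toSet.subset hsub₁
  have hf₂ : B₂.HasFiniteMulSupport := S.finite_toSet.subset hsub₂
  have hfh : ∀ j, (fun v : Place K => max 1 (normAbs v (x j)) ^ d j).HasFiniteMulSupport :=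
    fun j => Function.HasFiniteMulSupport.pow
      (f := fun v : Place K => max 1 (normAbs v (x j))) (height_finite_mulSupport (x j)) (d j)
  have hfH : H.HasFiniteMulSupport := Function.HasFiniteMulSupport.prod hfh _
  have h12 : (fun v => B₁ v * B₂ v).HasFiniteMulSupport := hf₁.mul hf₂
  have h123 : (fun v => B₁ v * B₂ v * H v).HasFiniteMulSupport := h12.mul hfH
  have hmain : 1 ≤ ∏ᶠ v, B₁ v * B₂ v * H v := by
    rw [← finprod_normAbs_eq_one hx]
    exact finprod_le_finprod (normAbs_hasFiniteMulSupport hx) (fun v => normAbs_nonneg v _) h123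
      hlocal
  have hprod₁ : ∏ᶠ v, B₁ v = l1 intAbv Q ^ T.card := by
    rw [finprod_eq_prod_of_mulSupport_subset _ hsub₁, ← Finset.prod_const]
    exact Finset.prod_congr rfl fun v hv => if_pos hv
  have hprod₂ : ∏ᶠ v, B₂ v = ∏ v ∈ S, ((1 + w v α) ^ (2 * ∑ j, d j) * E v) := by
    rw [finprod_eq_prod_of_mulSupport_subset _ hsub₂]
    exact Finset.prod_congr rfl fun v hv => if_pos hv
  have hprodH : ∏ᶠ v, H v = ∏ j, height (x j) ^ d j := by
    rw [finprod_prod_comm _ _ fun j _ => hfh j]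
    refine Finset.prod_congr rfl fun j _ => ?_
    rw [height, finprod_pow (height_finite_mulSupport (x j))]
  rw [finprod_mul_distrib h12 hfH, finprod_mul_distrib hf₁ hf₂, hprod₁, hprod₂, hprodH] at hmain
  refine hmain.trans ?_
  have hcard : T.card ≤ S.card + Fintype.card (InfinitePlace K) :=
    (Finset.card_union_le _ _).trans (Nat.add_le_add_left Finset.card_image_le _)
  refine mul_le_mul_of_nonneg_right (mul_le_mul_of_nonneg_right
    (pow_le_pow_right₀ hl hcard) ?_) ?_
  · exact Finset.prod_nonneg fun v hv => mul_nonneg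
      (pow_nonneg (by linarith [(w v).nonneg α]) _) (hE0 v hv)
  · exact Finset.prod_nonneg fun j _ => pow_nonneg (by linarith [one_le_height (x j)]) _

end Global

end Roth

namespace Roth

open MvPolynomial NumberField Height

/-! ### Pigeonhole and gap selection. -/

section Selection

/-- A coordinate exceeding `B` already suffices alone. Capping makes the exponents bounded, as the
pigeonhole argument requires. -/
theorem le_sum_min {ι : Type*} (S : Finset ι) {x : ι → ℝ} (hx : ∀ v ∈ S, 0 ≤ x v) {B : ℝ}
    (hB : 0 ≤ B) (hsum : B ≤ ∑ v ∈ S, x v) : B ≤ ∑ v ∈ S, min (x v) B := by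
  by_cases h : ∀ v ∈ S, x v ≤ B
  · rwa [Finset.sum_congr rfl fun v hv => min_eq_left (h v hv)]
  · push Not at h
    obtain ⟨v, hv, hvB⟩ := h
    calc B = min (x v) B := (min_eq_right hvB.le).symm
      _ ≤ _ := Finset.single_le_sum (f := fun v => min (x v) B)
        (fun u hu => le_min (hx u hu) hB) hv

/-- Among infinitely many non-negative vectors with coordinate sum at least `B + ε`, infinitely
many dominate a common non-negative vector with coordinate sum at least `B`. -/
theorem exists_common_lower_bound {ι X : Type*} (S : Finset ι) {Y : Set X} (hY : Y.Infinite)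
    (x : X → ι → ℝ) (hx : ∀ β ∈ Y, ∀ v ∈ S, 0 ≤ x β v) {B ε : ℝ} (hB : 0 < B) (hε : 0 < ε)
    (hsum : ∀ β ∈ Y, B + ε ≤ ∑ v ∈ S, x β v) :
    ∃ κ : ι → ℝ, (∀ v ∈ S, 0 ≤ κ v) ∧ B ≤ ∑ v ∈ S, κ v ∧
      {β | β ∈ Y ∧ ∀ v ∈ S, κ v ≤ x β v}.Infinite := by
  obtain ⟨n, hn⟩ := exists_nat_gt ((S.card : ℝ) / ε)
  have hn0 : (0 : ℝ) < n := lt_of_le_of_lt (by positivity) hn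
  rw [div_lt_iff₀ hε] at hn
  set N := ⌊(n : ℝ) * (B + ε)⌋₊
  -- Rounding down to multiples of `1/n` leaves finitely many vectors and loses at most `|S|/n ≤ ε`
  -- in total.
  let a : X → ι → ℕ := fun β v => ⌊(n : ℝ) * min (x β v) (B + ε)⌋₊
  have ha : ∀ β v, a β v < N + 1 := fun β v => Nat.lt_succ_of_le
    (Nat.floor_le_floor (mul_le_mul_of_nonneg_left (min_le_right _ _) hn0.le))
  let f : Y → S → Fin (N + 1) := fun β v => ⟨a β v, ha β v⟩
  have : Infinite Y := hY.to_subtype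
  obtain ⟨y, hy⟩ := Finite.exists_infinite_fiber f
  have hy' : (f ⁻¹' {y}).Infinite := Set.infinite_coe_iff.1 hy
  obtain ⟨β₀, hβ₀⟩ := hy'.nonempty
  refine ⟨fun v => a β₀ v / n, fun v _ => by positivity, ?_, ?_⟩
  · have h1 : B + ε ≤ ∑ v ∈ S, min (x β₀ v) (B + ε) :=
      le_sum_min S (hx β₀ β₀.2) (by linarith) (hsum β₀ β₀.2)
    have h2 : ∑ v ∈ S, min (x β₀ v) (B + ε) ≤ ∑ v ∈ S, ((a β₀ v : ℝ) / n + 1 / n) := by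
      refine Finset.sum_le_sum fun v _ => ?_
      rw [← add_div, le_div_iff₀ hn0, mul_comm]
      exact (Nat.lt_floor_add_one _).le
    have h3 : (S.card : ℝ) * (1 / n) ≤ ε := by
      rw [mul_one_div, div_le_iff₀ hn0]
      linarith
    rw [Finset.sum_add_distrib, Finset.sum_const, nsmul_eq_mul] at h2
    linarith
  · refine (hy'.image Subtype.val_injective.injOn).mono ?_
    rintro _ ⟨β, hβ, rfl⟩
    refine ⟨β.2, fun v hv => ?_⟩
    have h1 : f β = f β₀ := by rw [hβ, hβ₀]
    have h2 : a β v = a β₀ v := congrArg Fin.val (congrFun h1 ⟨v, hv⟩)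
    change (a β₀ v : ℝ) / n ≤ x β v
    rw [← h2, div_le_iff₀ hn0, mul_comm]
    refine (Nat.floor_le (mul_nonneg hn0.le (le_min (hx β β.2 v hv) (by linarith)))).trans ?_
    exact mul_le_mul_of_nonneg_left (min_le_left _ _) hn0.le

/-- Each new, much larger element is put in front, so index 0 has the largest height and will
receive the smallest degree, as `IndexBound` demands. -/
theorem exists_gap_sequence {X : Type*} {h : X → ℝ} (hh : ∀ x, 0 ≤ h x) {Y : Set X}
    (hY : ∀ T, ∃ x ∈ Y, T ≤ h x) {Λ : ℝ} (hΛ : 0 ≤ Λ) (T : ℝ) (m : ℕ) :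
    ∃ β : Fin m → X, (∀ j, β j ∈ Y) ∧ (∀ j, T ≤ h (β j)) ∧
      ∀ i j, i < j → Λ * h (β j) ≤ h (β i) := by
  induction m with
  | zero => exact ⟨Fin.elim0, fun j => j.elim0, fun j => j.elim0, fun j => j.elim0⟩
  | succ m ih =>
    obtain ⟨β, hβY, hβT, hβ⟩ := ih
    obtain ⟨b, hbY, hb⟩ := hY (max T (Λ * ∑ j, h (β j)))
    refine ⟨Fin.cons b β, fun j => ?_, fun j => ?_, fun i j hij => ?_⟩
    · cases j using Fin.cases <;> simp [hbY, hβY]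
    · cases j using Fin.cases
      · simpa using (le_max_left _ _).trans hb
      · simpa using hβT _
    · cases j using Fin.cases with
      | zero => exact absurd hij (Fin.not_lt_zero i)
      | succ j =>
        cases i using Fin.cases with
        | zero =>
          refine le_trans (mul_le_mul_of_nonneg_left ?_ hΛ) ((le_max_right _ _).trans hb)
          exact Finset.single_le_sum (f := fun j => h (β j)) (fun _ _ => hh _) (Finset.mem_univ j)
        | succ i => simpa using hβ i j (Fin.succ_lt_succ_iff.1 hij)

end Selection

/-! ### The contradiction. -/

section Main

variable {K : Type*} [Field K] [NumberField K]

theorem log_height_nonneg (x : K) : 0 ≤ Real.log (height x) := Real.log_nonneg (one_le_height x)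

/-- Infinitely many good approximations yield infinitely many which approximate at each place of
`S` with a fixed exponent. -/
theorem exists_exponents {L : Type*} [Field L] [Algebra K L] (S : Finset (Place K))
    (w : Place K → AbsoluteValue L ℝ) (α : L) {ε : ℝ} (hε : 0 < ε)
    (hinf : {β : K | ∏ v ∈ S, min 1 (w v (algebraMap K L β - α))
      < 1 / height β ^ (2 + ε)}.Infinite) :
    ∃ κ : Place K → ℝ, (∀ v ∈ S, 0 ≤ κ v) ∧ 2 + ε / 2 ≤ ∑ v ∈ S, κ v ∧
      {β : K | ∀ v ∈ S, min 1 (w v (algebraMap K L β - α)) ≤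
        Real.exp (-(κ v * Real.log (height β)))}.Infinite := by
  have hfin₁ : {β : K | algebraMap K L β = α}.Finite := Set.Subsingleton.finite
    fun a ha b hb => (algebraMap K L).injective (ha.trans hb.symm)
  -- Discarding `β = α` keeps the logarithms meaningful; discarding height 1 allows division by `log
  -- H(β)`.
  have hinf' := (hinf.sdiff hfin₁).sdiff (finite_log_height_le (K := K) 0)
  have hpos : ∀ β : K, algebraMap K L β ≠ α → ∀ v,
      0 < min 1 (w v (algebraMap K L β - α)) := fun β hβ v =>
    lt_min one_pos ((w v).pos (sub_ne_zero.2 hβ))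
  set Y := ({β : K | ∏ v ∈ S, min 1 (w v (algebraMap K L β - α))
      < 1 / height β ^ (2 + ε)} \ {β : K | algebraMap K L β = α}) \
      {β : K | Real.log (height β) ≤ 0}
  let x : K → Place K → ℝ := fun β v =>
    -Real.log (min 1 (w v (algebraMap K L β - α))) / Real.log (height β)
  have hx0 : ∀ β ∈ Y, ∀ v ∈ S, 0 ≤ x β v := by
    rintro β ⟨⟨-, hβα⟩, -⟩ v -
    exact div_nonneg (neg_nonneg.2 (Real.log_nonpos (hpos β hβα v).le (min_le_left _ _)))
      (log_height_nonneg β)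
  have hxsum : ∀ β ∈ Y, 2 + ε / 2 + ε / 2 ≤ ∑ v ∈ S, x β v := by
    rintro β ⟨⟨hβ, hβα⟩, hβh⟩
    have hh : 0 < Real.log (height β) := not_le.1 hβh
    have hH : 0 < height β := one_pos.trans_le (one_le_height β)
    rw [← Finset.sum_div, le_div_iff₀ hh, Finset.sum_neg_distrib,
      ← Real.log_prod fun v _ => (hpos β hβα v).ne']
    have h1 := Real.log_lt_log (Finset.prod_pos fun v _ => hpos β hβα v) hβ
    rw [one_div, Real.log_inv, Real.log_rpow hH] at h1
    linarith
  obtain ⟨κ, hκ0, hκ, hκinf⟩ :=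
    exists_common_lower_bound S hinf' x hx0 (by linarith) (by linarith) hxsum
  refine ⟨κ, hκ0, hκ, hκinf.mono ?_⟩
  rintro β ⟨⟨⟨-, hβα⟩, hβh⟩, hβ⟩ v hv
  have hh : 0 < Real.log (height β) := not_le.1 hβh
  have h1 := hβ v hv
  rw [le_div_iff₀ hh] at h1
  rw [← Real.log_le_iff_le_exp (hpos β hβα v)]
  linarith

/-- Weights `d j` making all `d j * h j` nearly equal. -/
theorem exists_balanced_degrees {m : ℕ} {h : Fin m → ℝ} (hh : ∀ j, 0 < h j) (hm : 0 < m) {δ : ℝ}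
    (hδ : 0 < δ) : ∃ (D : ℝ) (d : Fin m → ℕ), 0 < D ∧ (∀ j, 0 < d j) ∧
      (∀ j, D ≤ d j * h j) ∧ ∀ j, d j * h j ≤ (1 + δ) * D := by
  have hne : (Finset.univ : Finset (Fin m)).Nonempty := ⟨⟨0, hm⟩, Finset.mem_univ _⟩
  have hsum : 0 < ∑ j, h j := Finset.sum_pos (fun j _ => hh j) hne
  -- With this `D`, rounding `D / h j` up changes `d j * h j` by at most `h j ≤ δD`.
  set D := (∑ j, h j) / δ with hD
  have hD0 : 0 < D := div_pos hsum hδ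
  refine ⟨D, fun j => ⌈D / h j⌉₊, hD0, fun j => Nat.ceil_pos.2 (div_pos hD0 (hh j)),
    fun j => ?_, fun j => ?_⟩
  · rw [← div_le_iff₀ (hh j)]
    exact Nat.le_ceil _
  · have h1 := (Nat.ceil_lt_add_one (div_pos hD0 (hh j)).le).le
    have h2 : h j ≤ δ * D := by
      rw [hD, mul_div_cancel₀ _ hδ.ne']
      exact Finset.single_le_sum (fun j _ => (hh j).le) (Finset.mem_univ j)
    calc (⌈D / h j⌉₊ : ℝ) * h j ≤ (D / h j + 1) * h j :=
          mul_le_mul_of_nonneg_right h1 (hh j).le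
      _ = D + h j := by rw [add_mul, div_mul_cancel₀ _ (hh j).ne', one_mul]
      _ ≤ _ := by linarith

/-- Since `D ≤ d j * h j`, the sum `∑ J j * h j` is at least `D` times the weight of `J`. -/
theorem prod_pow_le_exp {m : ℕ} {d : Fin m → ℕ} (hd : ∀ j, 0 < d j) {h l : Fin m → ℝ} {κ D s : ℝ}
    (hκ : 0 ≤ κ) (hD : 0 ≤ D) (hDd : ∀ j, D ≤ d j * h j) (hl : ∀ j, 0 ≤ l j)
    (hlh : ∀ j, l j ≤ Real.exp (-(κ * h j))) (J : Fin m →₀ ℕ) (hJ : s ≤ wt d J) :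
    ∏ j, l j ^ J j ≤ Real.exp (-(κ * (D * s))) := by
  have h1 : D * s ≤ ∑ j, J j * h j := by
    refine (mul_le_mul_of_nonneg_left hJ hD).trans ?_
    rw [wt_apply, Finset.mul_sum]
    refine Finset.sum_le_sum fun j _ => ?_
    have hdj : (0 : ℝ) < d j := by exact_mod_cast hd j
    rw [mul_div_assoc', div_le_iff₀ hdj]
    nlinarith [mul_le_mul_of_nonneg_left (hDd j) (Nat.cast_nonneg (α := ℝ) (J j))]
  calc ∏ j, l j ^ J j ≤ ∏ j, Real.exp (-(κ * (J j * h j))) := by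
        refine Finset.prod_le_prod (fun j _ => pow_nonneg (hl j) _) fun j _ => ?_
        refine (pow_le_pow_left₀ (hl j) (hlh j) _).trans_eq ?_
        rw [← Real.exp_nat_mul]
        congr 1
        ring
    _ = Real.exp (-(κ * ∑ j, J j * h j)) := by
        rw [← Real.exp_sum, Finset.sum_neg_distrib, Finset.mul_sum]
    _ ≤ _ := Real.exp_le_exp.2 (neg_le_neg (mul_le_mul_of_nonneg_left h1 hκ))

theorem isAlgebraic_int {L : Type*} [Field L] [Algebra K L] {α : L} (hα : IsAlgebraic K α) :
    IsAlgebraic ℤ α := by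
  have : CharZero L := charZero_of_injective_algebraMap (algebraMap K L).injective
  rw [IsFractionRing.isAlgebraic_iff ℤ ℚ L]
  exact hα.restrictScalars ℚ

/-- The product formula for a non-zero value, in logarithmic form, when all approximations have
exponents at least `κ v`. -/
theorem log_inequality {L : Type*} [Field L] [Algebra K L] (S : Finset (Place K))
    (w : Place K → AbsoluteValue L ℝ) (hw : ∀ v ∈ S, Extends (w v) v) (α : L)
    {κ : Place K → ℝ} (hκ : ∀ v ∈ S, 0 ≤ κ v) {m : ℕ} {x : Fin m → K}
    (hx : ∀ j, ∀ v ∈ S, min 1 (w v (algebraMap K L (x j) - α)) ≤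
      Real.exp (-(κ v * Real.log (height (x j)))))
    {d : Fin m → ℕ} (hd : ∀ j, 0 < d j) {D : ℝ} (hD : 0 ≤ D)
    (hDd : ∀ j, D ≤ d j * Real.log (height (x j))) {Q : MvPolynomial (Fin m) ℤ}
    (hdeg : ∀ j, degreeOf j Q ≤ d j) (hQ : aeval x Q ≠ 0) {s : ℝ}
    (hs : SuppGE (wt d) s (translate (fun _ => α) Q)) :
    (∑ v ∈ S, κ v) * (D * s) ≤
      (S.card + Fintype.card (InfinitePlace K)) * Real.log (l1 intAbv Q) +
      (∑ v ∈ S, 2 * Real.log (1 + w v α)) * (∑ j, (d j : ℝ)) +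
      ∑ j, d j * Real.log (height (x j)) := by
  have h := one_le_of_aeval_ne_zero S w hw α x hdeg hQ hs
    (E := fun v => Real.exp (-(κ v * (D * s)))) (fun v _ => (Real.exp_pos _).le)
    fun v hv J hJ => prod_pow_le_exp hd (hκ v hv) hD hDd
      (fun j => le_min zero_le_one ((w v).nonneg _)) (fun j => hx j v hv) J hJ
  have hQ0 : Q ≠ 0 := fun h => hQ (by rw [h, map_zero])
  have hl : 0 < l1 intAbv Q := one_pos.trans_le (one_le_l1 hQ0)
  have hH : ∀ j, 0 < height (x j) := fun j => one_pos.trans_le (one_le_height _)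
  have hA : ∀ v, 0 < 1 + w v α := fun v => by linarith [(w v).nonneg α]
  have h1 : 0 < ∏ v ∈ S, ((1 + w v α) ^ (2 * ∑ j, d j) * Real.exp (-(κ v * (D * s)))) :=
    Finset.prod_pos fun v _ => mul_pos (pow_pos (hA v) _) (Real.exp_pos _)
  have h2 : 0 < ∏ j, height (x j) ^ d j := Finset.prod_pos fun j _ => pow_pos (hH j) _
  have h3 := Real.log_le_log one_pos h
  rw [Real.log_one, Real.log_mul (mul_pos (pow_pos hl _) h1).ne' h2.ne',
    Real.log_mul (pow_pos hl _).ne' h1.ne', Real.log_pow,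
    Real.log_prod fun v _ => (mul_pos (pow_pos (hA v) _) (Real.exp_pos _)).ne',
    Real.log_prod fun j _ => (pow_pos (hH j) _).ne',
    Finset.sum_congr rfl fun v _ => Real.log_mul (pow_pos (hA v) _).ne' (Real.exp_pos _).ne',
    Finset.sum_add_distrib] at h3
  simp only [Real.log_pow, Real.log_exp, Finset.sum_neg_distrib, ← Finset.sum_mul] at h3
  rw [← Finset.mul_sum] at h3 ⊢
  push_cast at h3
  linarith

/-- Approximation exponents with sum exceeding `2` are attained only finitely often. -/
theorem finite_of_two_lt_sum {L : Type*} [Field L] [Algebra K L] (S : Finset (Place K))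
    (w : Place K → AbsoluteValue L ℝ) (hw : ∀ v ∈ S, Extends (w v) v) {α : L}
    (hα : IsAlgebraic K α) {κ : Place K → ℝ} (hκ : ∀ v ∈ S, 0 ≤ κ v) {ε : ℝ} (hε : 0 < ε)
    (hε1 : ε ≤ 1) (hsum : 2 + ε ≤ ∑ v ∈ S, κ v) :
    {β : K | ∀ v ∈ S, min 1 (w v (algebraMap K L β - α)) ≤
        Real.exp (-(κ v * Real.log (height β)))}.Finite := by
  by_contra hinf
  rw [← Set.Infinite] at hinf
  have : CharZero L := charZero_of_injective_algebraMap (algebraMap K L).injective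
  set Y := {β : K | ∀ v ∈ S, min 1 (w v (algebraMap K L β - α)) ≤
        Real.exp (-(κ v * Real.log (height β)))}
  have hY : ∀ T, ∃ x ∈ Y, T ≤ Real.log (height x) := fun T => by
    obtain ⟨x, hx, hxT⟩ := (hinf.sdiff (finite_log_height_le (K := K) T)).nonempty
    exact ⟨x, hx, (not_le.1 hxT).le⟩
  set δ := ε / 40 with hδ
  have hδ0 : 0 < δ := by positivity
  obtain ⟨m, C₁, hm, hC₁, haux⟩ :=
    exists_auxiliary_polynomial (isAlgebraic_int hα) hδ0 (by linarith)
  obtain ⟨C₂, hC₂, hroth⟩ := indexBound (K := K) m δ hδ0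
  have hm1 : (1 : ℝ) ≤ m := by exact_mod_cast hm
  have hlogC : 0 ≤ Real.log (2 * C₁) := Real.log_nonneg (by linarith)
  set τ : ℝ := S.card + Fintype.card (InfinitePlace K) with hτ
  have hτ0 : 0 ≤ τ := by positivity
  set A := ∑ v ∈ S, 2 * Real.log (1 + w v α) with hA
  have hA0 : 0 ≤ A := Finset.sum_nonneg fun v _ =>
    mul_nonneg zero_le_two (Real.log_nonneg (by linarith [(w v).nonneg α]))
  set c := τ * Real.log (2 * C₁) + A with hc
  have hc0 : 0 ≤ c := by positivity
  -- Heights above `T` give `T * ∑ d j ≤ 2mD`. The middle term then meets the size hypothesis of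
  -- Roth's lemma, and the last bounds the constants by `(ε/5)·mD`.
  set T := 1 + 2 * m * C₂ * (Real.log (2 * C₁) + 1) + 10 * c / ε with hT
  have hT₁ : 2 * m * C₂ * (Real.log (2 * C₁) + 1) ≤ T := by
    have : 0 ≤ 10 * c / ε := by positivity
    linarith
  have hTpos : 0 < T := by positivity
  have hT₂ : 10 * c ≤ ε * T := by
    rw [← div_le_iff₀' hε]
    have : 0 ≤ 2 * m * C₂ * (Real.log (2 * C₁) + 1) := by positivity
    linarith
  obtain ⟨x, hxY, hxT, hgap⟩ :=
    exists_gap_sequence log_height_nonneg hY (Λ := 2 * C₂) (by linarith) T m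
  have hx0 : ∀ j, 0 < Real.log (height (x j)) := fun j => hTpos.trans_le (hxT j)
  obtain ⟨D, d, hD0, hd0, hDd, hdD⟩ := exists_balanced_degrees hx0 hm hδ0
  have hdT : T * ∑ j, (d j : ℝ) ≤ 2 * m * D := by
    have h1 : ∀ j, T * d j ≤ 2 * D := fun j => by
      have := mul_le_mul_of_nonneg_left (hxT j) (Nat.cast_nonneg (α := ℝ) (d j))
      have h2 : (1 + δ) * D ≤ 2 * D := mul_le_mul_of_nonneg_right (by linarith) hD0.le
      linarith [hdD j]
    calc T * ∑ j, (d j : ℝ) = ∑ j, T * (d j : ℝ) := Finset.mul_sum _ _ _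
      _ ≤ ∑ _j : Fin m, 2 * D := Finset.sum_le_sum fun j _ => h1 j
      _ = _ := by rw [Finset.sum_const, Finset.card_univ, Fintype.card_fin, nsmul_eq_mul]; ring
  have hd0' : 0 ≤ ∑ j, (d j : ℝ) := Finset.sum_nonneg fun _ _ => Nat.cast_nonneg _
  obtain ⟨P, hP, hPdeg, hPl, hPα⟩ := haux d hd0
  have hPl0 := one_le_l1 hP
  have hsumcast : ((∑ j, d j : ℕ) : ℝ) = ∑ j, (d j : ℝ) := by push_cast; rfl
  have hlogP : Real.log (l1 intAbv P) ≤ Real.log (2 * C₁) * ∑ j, (d j : ℝ) := by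
    have h1 := Real.log_le_log (by linarith) hPl
    rw [Real.log_pow, hsumcast] at h1
    have h2 : Real.log C₁ ≤ Real.log (2 * C₁) := Real.log_le_log (by linarith) (by linarith)
    rw [mul_comm] at h1
    exact h1.trans (mul_le_mul_of_nonneg_right h2 hd0')
  -- The gap factor `2 * C₂` for the heights becomes `C₂` for the degrees, the 2 absorbing the
  -- imbalance `1 + δ`.
  obtain ⟨e, he, heδ⟩ := hroth d x P hd0 (fun i j hij => by
      have h1 := hgap i j hij
      have h2 := hdD i
      have h3 := hDd j
      have hdi : (0 : ℝ) ≤ d i := Nat.cast_nonneg _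
      have h4 : (d i : ℝ) * (2 * C₂ * Real.log (height (x j))) ≤ 2 * D :=
        (mul_le_mul_of_nonneg_left h1 hdi).trans (h2.trans (by gcongr; linarith))
      exact le_of_mul_le_mul_right (by linarith) (hx0 j)) hP hPdeg (fun j => by
      rw [← finrank_mul_log_height]
      have h1 : (1 : ℝ) ≤ Module.finrank ℚ K := by
        exact_mod_cast (Module.finrank_pos (R := ℚ) (M := K))
      have h2 : D ≤ d j * (Module.finrank ℚ K * Real.log (height (x j))) := by
        refine (hDd j).trans (mul_le_mul_of_nonneg_left ?_ (Nat.cast_nonneg _))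
        exact le_mul_of_one_le_left (hx0 j).le h1
      refine le_trans ?_ h2
      have h3 : C₂ * (Real.log (l1 intAbv P) + ∑ i, (d i : ℝ)) ≤
          C₂ * ((Real.log (2 * C₁) + 1) * ∑ i, (d i : ℝ)) :=
        mul_le_mul_of_nonneg_left (by linarith) (by linarith)
      have h4 : 2 * m * C₂ * (Real.log (2 * C₁) + 1) * (∑ j, (d j : ℝ)) ≤ 2 * m * D :=
        (mul_le_mul_of_nonneg_right hT₁ hd0').trans hdT
      refine h3.trans (le_of_mul_le_mul_left ?_ (show (0 : ℝ) < 2 * m by linarith))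
      linarith)
  set Q := hasse e P with hQ
  have hQdeg : ∀ j, degreeOf j Q ≤ d j := fun j => (degreeOf_hasse_le P e j).trans (hPdeg j)
  have hQx : aeval x Q ≠ 0 := by rwa [hQ, aeval_hasse]
  have hQ0 : Q ≠ 0 := fun h => hQx (by rw [h, map_zero])
  have hQα : SuppGE (wt d) (m * (1 / 2 - 2 * δ)) (translate (fun _ => α) Q) := by
    rw [hQ, ← hasse_translate]
    exact (hPα.hasse e).mono (by linarith [mul_le_mul_of_nonneg_right hm1 hδ0.le])
  have hlogQ : Real.log (l1 intAbv Q) ≤ Real.log (2 * C₁) * ∑ j, (d j : ℝ) := by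
    have h1 : l1 intAbv Q ≤ (2 * C₁) ^ (∑ j, d j) := by
      rw [mul_pow]
      exact (l1_hasse_le hPdeg e).trans (mul_le_mul_of_nonneg_left hPl (by positivity))
    have h2 := Real.log_le_log (one_pos.trans_le (one_le_l1 hQ0)) h1
    rwa [Real.log_pow, hsumcast, mul_comm] at h2
  have hfinal := log_inequality S w hw α hκ hxY hd0 hD0.le hDd hQdeg hQx hQα
  have h1 : ∑ j, d j * Real.log (height (x j)) ≤ m * ((1 + δ) * D) := by
    calc ∑ j, d j * Real.log (height (x j)) ≤ ∑ _j : Fin m, (1 + δ) * D :=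
          Finset.sum_le_sum fun j _ => hdD j
      _ = _ := by rw [Finset.sum_const, Finset.card_univ, Fintype.card_fin, nsmul_eq_mul]
  have h2 : τ * Real.log (l1 intAbv Q) + A * ∑ j, (d j : ℝ) ≤ c * ∑ j, (d j : ℝ) := by
    have := mul_le_mul_of_nonneg_left hlogQ hτ0
    rw [hc, add_mul]
    linarith
  have h3 : c * ∑ j, (d j : ℝ) ≤ ε / 5 * (m * D) := by
    have h4 := mul_le_mul_of_nonneg_right hT₂ hd0'
    have h5 := mul_le_mul_of_nonneg_left hdT hε.le
    linarith
  have hmD : 0 < m * D := by positivity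
  have h4 : (2 + ε) * (1 / 2 - 2 * δ) * (m * D) ≤ (∑ v ∈ S, κ v) * (D * (m * (1 / 2 - 2 * δ))) := by
    have : 0 ≤ (1 / 2 - 2 * δ) * (m * D) := mul_nonneg (by linarith) hmD.le
    have := mul_le_mul_of_nonneg_right hsum this
    linarith
  have h5 : (2 + ε) * (1 / 2 - 2 * δ) * (m * D) ≤ (ε / 5 + (1 + δ)) * (m * D) := by
    linarith
  have h6 := le_of_mul_le_mul_right h5 hmD
  rw [hδ] at h6
  -- With `δ = ε/40` the left side is `1 + 2ε/5 - ε²/20` and the right side `1 + 9ε/40`, which is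
  -- impossible for `0 < ε ≤ 1`.
  nlinarith

end Main

end Roth

theorem mainTheorem1 (K : Type*) [Field K] [NumberField K]
    (S : Finset (Roth.Place K))
    (w : Roth.Place K → AbsoluteValue (AlgebraicClosure K) ℝ)
    (hw : ∀ v ∈ S, Roth.Extends (w v) v)
    (α : AlgebraicClosure K) (ε : ℝ) (hε : 0 < ε) :
    {β : K | ∏ v ∈ S, min 1 (w v (algebraMap K (AlgebraicClosure K) β - α))
      < 1 / Roth.height β ^ (2 + ε)}.Finite := by
  by_contra hinf
  obtain ⟨κ, hκ, hsum, hκinf⟩ := Roth.exists_exponents S w α hε hinf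
  refine hκinf (Roth.finite_of_two_lt_sum S w hw (Algebra.IsAlgebraic.isAlgebraic α) hκ
    (ε := min (ε / 2) 1) (lt_min (by linarith) one_pos) (min_le_right _ _) ?_)
  linarith [min_le_left (ε / 2) 1]
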